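/- Let $d\in\{2,3\}$ and let $\Omega\subset\mathbb R^d$ be a bounded polygonal (polyhedral) domain with a conforming simplicial mesh $\mathcal T_h$ (triangles or tetrahedra). Let $\partial\Omega=\Gamma_D\cup\Gamma_N$, where each of $\Gamma_D$, $\Gamma_N$ is a union of boundary facets of the mesh and $\Gamma_D$ contains at least one facet. Assume that $\mathcal T_h$ can be partitioned into macroelements, each of which consists of all elements sharing some interior vertex of the mesh. Let $A(x)$ be a compliance tensor: a symmetric, bounded, uniformly positive definite linear operator on the space $\mathbb M$ of real $d\times d$ matrices with the Frobenius product $\sigma:\tau$, defined on each closed element (it may jump across element boundaries). Let - $\mathbb X_h$ be the space of matrix fields $\tau\in L^2(\Omega,\mathbb M)$ with row-wise weak divergence in $L^2$, with $\tau n=0$ on $\Gamma_N$, that are affine on each element; - $V_h$ be the space of vector fields that are constant on each element; - $\mathbb W_h$ be the space of continuous fields of skew-symmetric matrices that are affine on each element. With the vertex quadrature rule $$(\varphi,\psi)_Q=\sum_{E\in\mathcal T_h}\frac{|E|}{d+1}\sum_{\mathbf r\text{ vertex of }E}\varphi|_E(\mathbf r):\psi|_E(\mathbf r),$$ and bases $(\tau_j)$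 of $\mathbb X_h$, $(v_i)$ of $V_h$, $(\xi_i)$ of $\mathbb W_h$, put $$(A_{\sigma\sigma})_{ij}=(A\tau_j,\tau_i)_Q,\qquad (A_{\sigma u})_{ij}=(\operatorname{div}\tau_j,v_i),\qquad (A_{\sigma\gamma})_{ij}=(\tau_j,\xi_i)_Q .$$ These are the matrices of the multipoint stress mixed finite element method with linear rotations (MSMFE-1), whose algebraic system is $$A_{\sigma\sigma}\sigma+A_{\sigma u}^Tu+A_{\sigma\gamma}^T\gamma=g,\qquad -A_{\sigma u}\sigma=-f,\qquad -A_{\sigma\gamma}\sigma=0 .$$ Then: 1. For all bases, $A_{\sigma\sigma}$ is symmetric positive definite and $C=A_{\sigma\gamma}A_{\sigma\sigma}^{-1}A_{\sigma\gamma}^T$ is invertible. 2. Let the bases of $\mathbb X_h$ and $\mathbb W_h$ be nodal. That is, the basis of $\mathbb X_h$ is dual to the degrees of freedom given by the $d$ components of $\tau n$ at the vertices of each facet not on $\Gamma_N$. The basis functions of $\mathbb W_h$ are the piecewise linear hat functions of the vertices times the $d(d-1)/2$ matrices $\Xi(e_k)$, where $$\Xi(p)=\begin{pmatrix}0&p\\-p&0\end{pmatrix}\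 (d=2),\qquad \Xi(p)=\begin{pmatrix}0&-p_3&p_2\\p_3&0&-p_1\\-p_2&p_1&0\end{pmatrix}\ (d=3).$$ Then $C$ is block-diagonal, with one invertible $\frac{d(d-1)}2\times\frac{d(d-1)}2$ block for each mesh vertex. 3. For all bases, the stress and the rotation can be eliminated. Let $$S=A_{\sigma u}A_{\sigma\sigma}^{-1}A_{\sigma u}^T-A_{\sigma u}A_{\sigma\sigma}^{-1}A_{\sigma\gamma}^T\,C^{-1}A_{\sigma\gamma}A_{\sigma\sigma}^{-1}A_{\sigma u}^T .$$ For all $g$ and $f$, $(\sigma,u,\gamma)$ solves the algebraic system if and only if $$Su=A_{\sigma u}A_{\sigma\sigma}^{-1}g-f-A_{\sigma u}A_{\sigma\sigma}^{-1}A_{\sigma\gamma}^TC^{-1}A_{\sigma\gamma}A_{\sigma\sigma}^{-1}g,$$ $$\gamma=C^{-1}A_{\sigma\gamma}A_{\sigma\sigma}^{-1}(g-A_{\sigma u}^Tu),\qquad \sigma=A_{\sigma\sigma}^{-1}(g-A_{\sigma u}^Tu-A_{\sigma\gamma}^T\gamma).$$ 4. For all bases, the matrix $S$ of the resulting displacement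 system is symmetric and positive definite. With the standard basis of $V_h$, its unknowns are the values of the displacement on the elements. -/

import Mathlib

open scoped ContDiff Matrix
open MeasureTheory

namespace MSMFE

/-! ### Tensors and function spaces on a domain of `ℝ^d` -/

/-- Euclidean space `ℝ^d`. -/
abbrev Pt (d : ℕ) : Type := EuclideanSpace ℝ (Fin d)

/-- The space of real `d × d` matrices. -/
abbrev Tensor (d : ℕ) : Type := Matrix (Fin d) (Fin d) ℝ

/-- The `j`-th coordinate vector. -/
noncomputable abbrev e {d : ℕ} (j : Fin d) : Pt d := EuclideanSpace.single j (1 : ℝ)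

/-- The Frobenius product `σ : τ`. -/
def ddot {d : ℕ} (σ τ : Tensor d) : ℝ := ∑ i, ∑ j, σ i j * τ i j

/-- `τ ∈ L²(Ω, 𝕄)`. -/
def MemL2Tensor {d : ℕ} (Ω : Set (Pt d)) (τ : Pt d → Tensor d) : Prop :=
  ∀ i j, MemLp (fun x => τ x i j) 2 (volume.restrict Ω)

/-- `g ∈ L²(Ω, ℝ^d)`. -/
def MemL2Vector {d : ℕ} (Ω : Set (Pt d)) (g : Pt d → Fin d → ℝ) : Prop :=
  ∀ i, MemLp (fun x => g x i) 2 (volume.restrict Ω)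

/-- `g` is the weak (row-wise) divergence of the matrix field `τ` on the open set `Ω`. -/
def IsWeakDiv {d : ℕ} (Ω : Set (Pt d)) (τ : Pt d → Tensor d) (g : Pt d → Fin d → ℝ) : Prop :=
  ∀ (i : Fin d) (φ : Pt d → ℝ), ContDiff ℝ ∞ φ → HasCompactSupport φ → tsupport φ ⊆ Ω →
    ∫ x in Ω, ∑ j, τ x i j * fderiv ℝ φ x (e j) = - ∫ x in Ω, g x i * φ x

/-- For `τ` with weak divergence `g`: the normal trace `τ n` vanishes on `∂Ω ∖ Γ_D`, in the usual
weak sense, i.e. `⟨τ n, φ⟩_{∂Ω} = (τ, ∇φ) + (div τ, φ) = 0` for all test functions `φ` that vanish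
on `Γ_D` (tested row by row). -/
def NormalTraceVanishesOff {d : ℕ} (Ω ΓD : Set (Pt d)) (τ : Pt d → Tensor d)
    (g : Pt d → Fin d → ℝ) : Prop :=
  ∀ (i : Fin d) (φ : Pt d → ℝ), ContDiff ℝ ∞ φ → HasCompactSupport φ → (∀ x ∈ ΓD, φ x = 0) →
    (∫ x in Ω, ∑ j, τ x i j * fderiv ℝ φ x (e j)) + ∫ x in Ω, g x i * φ x = 0

/-- Membership in `𝕏 = {τ ∈ H(div; Ω, 𝕄) : τ n = 0 on Γ_N}`, where `Γ_N = ∂Ω ∖ Γ_D`. -/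
def MemStress {d : ℕ} (Ω ΓD : Set (Pt d)) (τ : Pt d → Tensor d) : Prop :=
  MemL2Tensor Ω τ ∧ ∃ g : Pt d → Fin d → ℝ,
    MemL2Vector Ω g ∧ IsWeakDiv Ω τ g ∧ NormalTraceVanishesOff Ω ΓD τ g

section closure_facts

variable {d : ℕ} {Ω ΓD : Set (Pt d)}

lemma memLp_of_test {φ : Pt d → ℝ} (h : Continuous φ) (hc : HasCompactSupport φ) :
    MemLp φ 2 (volume.restrict Ω) :=
  (h.memLp_of_hasCompactSupport hc).restrict Ω

lemma integrable_grad {τ : Pt d → Tensor d} (hτ : MemL2Tensor Ω τ) (i : Fin d) {φ : Pt d → ℝ}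
    (h : ContDiff ℝ ∞ φ) (hc : HasCompactSupport φ) :
    Integrable (fun x => ∑ j, τ x i j * fderiv ℝ φ x (e j)) (volume.restrict Ω) := by
  refine integrable_finsetSum _ fun j _ => ?_
  refine (hτ i j).integrable_mul (memLp_of_test ?_ ?_)
  · exact (h.continuous_fderiv (by simp)).clm_apply continuous_const
  · exact (hc.fderiv (𝕜 := ℝ)).comp_left (g := fun L : Pt d →L[ℝ] ℝ => L (e j)) (by simp)

lemma integrable_val {g : Pt d → Fin d → ℝ} (hg : MemL2Vector Ω g) (i : Fin d) {φ : Pt d → ℝ}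
    (h : ContDiff ℝ ∞ φ) (hc : HasCompactSupport φ) :
    Integrable (fun x => g x i * φ x) (volume.restrict Ω) :=
  (hg i).integrable_mul (memLp_of_test h.continuous hc)

lemma MemStress.zero : MemStress Ω ΓD (0 : Pt d → Tensor d) := by
  refine ⟨fun i j => by simp, 0, fun i => by simp, ?_, ?_⟩
  · intro i φ _ _ _; simp
  · intro i φ _ _ _; simp

lemma MemStress.add {σ τ : Pt d → Tensor d} (hσ : MemStress Ω ΓD σ) (hτ : MemStress Ω ΓD τ) :
    MemStress Ω ΓD (σ + τ) := by
  obtain ⟨s2, g, g2, gd, gn⟩ := hσ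
  obtain ⟨t2, k, k2, kd, kn⟩ := hτ
  refine ⟨fun i j => (s2 i j).add (t2 i j), g + k, fun i => (g2 i).add (k2 i), ?_, ?_⟩
  · intro i φ h hc hs
    have h1 := gd i φ h hc hs
    have h2 := kd i φ h hc hs
    simp only [Pi.add_apply, Matrix.add_apply, add_mul, Finset.sum_add_distrib]
    rw [integral_add (integrable_grad s2 i h hc) (integrable_grad t2 i h hc),
      integral_add (integrable_val g2 i h hc) (integrable_val k2 i h hc), h1, h2]
    ring
  · intro i φ h hc hs
    have h1 := gn i φ h hc hs
    have h2 := kn i φ h hc hs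
    simp only [Pi.add_apply, Matrix.add_apply, add_mul, Finset.sum_add_distrib]
    rw [integral_add (integrable_grad s2 i h hc) (integrable_grad t2 i h hc),
      integral_add (integrable_val g2 i h hc) (integrable_val k2 i h hc)]
    linarith

lemma MemStress.smul {τ : Pt d → Tensor d} (c : ℝ) (hτ : MemStress Ω ΓD τ) :
    MemStress Ω ΓD (c • τ) := by
  obtain ⟨t2, k, k2, kd, kn⟩ := hτ
  refine ⟨fun i j => (t2 i j).const_mul c, c • k, fun i => (k2 i).const_mul c, ?_, ?_⟩
  · intro i φ h hc hs
    have h2 := kd i φ h hc hs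
    simp only [Pi.smul_apply, Matrix.smul_apply, smul_eq_mul, mul_assoc, ← Finset.mul_sum,
      integral_const_mul]
    rw [h2]; ring
  · intro i φ h hc hs
    have h2 := kn i φ h hc hs
    simp only [Pi.smul_apply, Matrix.smul_apply, smul_eq_mul, mul_assoc, ← Finset.mul_sum,
      integral_const_mul]
    rw [← mul_add, h2, mul_zero]

end closure_facts

/-! ### Simplicial meshes -/

/-- A conforming simplicial finite element mesh of a bounded polygonal (polyhedral) domain
`Ω ⊂ ℝ^d`, together with a splitting of the boundary facets into Neumann and Dirichlet facets, at
least one of which is a Dirichlet facet. The domain is recovered as the interior of the union of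
the closed elements. -/
structure Mesh (d : ℕ) where
  /-- all simplices of the mesh (elements, facets, …, vertices), given by their vertex sets -/
  complex : Geometry.SimplicialComplex ℝ (Pt d)
  finite : complex.faces.Finite
  /-- every simplex is a face of a `d`-dimensional one -/
  pure : ∀ s ∈ complex.faces, ∃ t ∈ complex.faces, s ⊆ t ∧ t.card = d + 1
  /-- the domain is connected -/
  connected : IsConnected (interior complex.space)
  /-- the facets that make up `Γ_N` -/
  neumann : Set (Finset (Pt d))
  neumann_boundary : ∀ F ∈ neumann, F ∈ complex.faces ∧ F.card = d ∧
    convexHull ℝ (F : Set (Pt d)) ⊆ frontier (interior complex.space)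
  /-- `Γ_D` is not empty -/
  exists_dirichlet : ∃ F ∈ complex.faces, F.card = d ∧
    convexHull ℝ (F : Set (Pt d)) ⊆ frontier (interior complex.space) ∧ F ∉ neumann

namespace Mesh

variable {d : ℕ} (M : Mesh d)

/-- The domain `Ω`. -/
def domain : Set (Pt d) := interior M.complex.space

/-- The elements `E ∈ 𝒯_h`, given by their vertex sets. -/
def Cell : Type := {s : Finset (Pt d) // s ∈ M.complex.faces ∧ s.card = d + 1}

variable {M} in
/-- The set of vertices of an element. -/
def Cell.verts (E : M.Cell) : Finset (Pt d) := E.1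

variable {M} in
/-- The element as a (closed) subset of `ℝ^d`. -/
def Cell.carrier (E : M.Cell) : Set (Pt d) := convexHull ℝ (E.verts : Set (Pt d))

variable {M} in
/-- The volume `|E|`. -/
noncomputable def Cell.vol (E : M.Cell) : ℝ := volume.real E.carrier

instance : Finite M.Cell := (M.finite.subset fun _ h => h.1 : Set.Finite
  {s : Finset (Pt d) | s ∈ M.complex.faces ∧ s.card = d + 1}).to_subtype

noncomputable instance : Fintype M.Cell := Fintype.ofFinite _

/-- The facets (edges for `d = 2`, faces for `d = 3`), given by their vertex sets. -/
def facets : Set (Finset (Pt d)) := {F | F ∈ M.complex.faces ∧ F.card = d}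

/-- The facets lying on `∂Ω`. -/
def boundaryFacets : Set (Finset (Pt d)) :=
  {F | F ∈ M.facets ∧ convexHull ℝ (F : Set (Pt d)) ⊆ frontier M.domain}

/-- The Dirichlet boundary: the union of the boundary facets that do not belong to `Γ_N`. -/
def dirichlet : Set (Pt d) :=
  ⋃ F ∈ M.boundaryFacets \ M.neumann, convexHull ℝ (F : Set (Pt d))

/-- The vertices of the mesh. -/
def Vertex : Type := {r : Pt d // r ∈ M.complex.vertices}

/-- The indices of the normal stress degrees of freedom: a facet that is not on `Γ_N`, a vertex of
that facet, and a component of the normal stress there. -/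
def StressDof : Type :=
  {q : Finset (Pt d) × Pt d × Fin d // q.1 ∈ M.facets ∧ q.1 ∉ M.neumann ∧ q.2.1 ∈ q.1}

instance : Finite M.Vertex := by
  have : (M.complex.vertices).Finite :=
    (M.finite.preimage (Finset.singleton_injective.injOn) :
      ((fun x : Pt d => ({x} : Finset (Pt d))) ⁻¹' M.complex.faces).Finite)
  exact this.to_subtype

instance : Finite M.StressDof := by
  have h : (M.complex.faces ×ˢ ((⋃ F ∈ M.complex.faces, (F : Set (Pt d))) ×ˢ
      (Set.univ : Set (Fin d)))).Finite :=
    M.finite.prod ((M.finite.biUnion fun F _ => F.finite_toSet).prod Set.finite_univ)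
  refine (h.subset ?_ : Set.Finite
    {q : Finset (Pt d) × Pt d × Fin d | q.1 ∈ M.facets ∧ q.1 ∉ M.neumann ∧ q.2.1 ∈ q.1}).to_subtype
  rintro ⟨F, r, i⟩ ⟨h1, -, h3⟩
  exact ⟨h1.1, Set.mem_biUnion h1.1 h3, trivial⟩

noncomputable instance : Fintype M.Vertex := Fintype.ofFinite _
noncomputable instance : Fintype M.StressDof := Fintype.ofFinite _
noncomputable instance : DecidableEq M.Vertex := Classical.decEq _
noncomputable instance : DecidableEq M.StressDof := Classical.decEq _

/-- The mesh is partitioned into macroelements, each of which consists of all elements that share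
some interior vertex `c` of the mesh: every element belongs to exactly one of them. -/
def HasMacroelementPartition : Prop :=
  ∃ C : Set (Pt d), (∀ c ∈ C, c ∈ M.complex.vertices ∧ c ∈ M.domain) ∧
    ∀ E : M.Cell, ∃! c, c ∈ C ∧ c ∈ E.verts

/-! ### The finite element spaces -/

/-- Element-wise affine tensor fields: an independent affine tensor field on each element. -/
abbrev BrokenP1 : Type := M.Cell → (Pt d →ᵃ[ℝ] Tensor d)

/-- The matrix field on `ℝ^d` that equals `τ E` in the interior of each element `E`
(and `0` on the null set of element boundaries and outside the mesh). -/
noncomputable def field (τ : M.BrokenP1) (x : Pt d) : Tensor d :=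
  ∑ E : M.Cell, (interior E.carrier).indicator (fun y => τ E y) x

lemma field_zero : M.field 0 = 0 := by
  funext x
  simp [field, Set.indicator]

lemma field_add (σ τ : M.BrokenP1) : M.field (σ + τ) = M.field σ + M.field τ := by
  funext x
  simp only [field, Pi.add_apply, ← Finset.sum_add_distrib]
  refine Finset.sum_congr rfl fun E _ => ?_
  by_cases h : x ∈ interior E.carrier <;> simp [h]

lemma field_smul (c : ℝ) (τ : M.BrokenP1) : M.field (c • τ) = c • M.field τ := by
  funext x
  simp only [field, Pi.smul_apply, Finset.smul_sum]
  refine Finset.sum_congr rfl fun E _ => ?_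
  by_cases h : x ∈ interior E.carrier <;> simp [h]

/-- The stress space `𝕏_h = (BDM_1)^d`: the fields in `𝕏` whose restriction to each element is a
`P_1` matrix field (the Piola transform maps `P_1` matrix fields on the reference simplex onto
those on the element). -/
noncomputable def stressSpace : Submodule ℝ M.BrokenP1 where
  carrier := {τ | MemStress M.domain M.dirichlet (M.field τ)}
  zero_mem' := by
    simp only [Set.mem_ofPred_eq, field_zero]
    exact MemStress.zero
  add_mem' := by
    intro σ τ hσ hτ
    simp only [Set.mem_ofPred_eq, field_add] at *
    exact hσ.add hτ
  smul_mem' := by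
    intro c τ hτ
    simp only [Set.mem_ofPred_eq, field_smul] at *
    exact hτ.smul c

/-- The displacement space `V_h = (P_0)^d` of element-wise constant vector fields. -/
abbrev DisplacementSpace : Type := M.Cell → Fin d → ℝ

/-- The rotation space `𝕎_h^1`: continuous fields of skew-symmetric matrices that are affine on
each element. -/
def rotationSpace : Submodule ℝ M.BrokenP1 where
  carrier := {ξ | (∀ E : M.Cell, ∀ x ∈ E.carrier, (ξ E x)ᵀ = -(ξ E x)) ∧
    ∃ f : Pt d → Tensor d, ContinuousOn f M.complex.space ∧
      ∀ E : M.Cell, ∀ x ∈ E.carrier, f x = ξ E x}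
  zero_mem' := ⟨fun E x _ => by simp, 0, continuousOn_const, fun E x _ => by simp⟩
  add_mem' := by
    rintro ξ η ⟨h1, f, hf, h2⟩ ⟨k1, g, hg, k2⟩
    refine ⟨fun E x hx => ?_, f + g, hf.add hg, fun E x hx => ?_⟩
    · show (ξ E x + η E x)ᵀ = -(ξ E x + η E x)
      rw [Matrix.transpose_add, h1 E x hx, k1 E x hx, neg_add]
    · simp [h2 E x hx, k2 E x hx]
  smul_mem' := by
    rintro c ξ ⟨h1, f, hf, h2⟩
    refine ⟨fun E x hx => ?_, c • f, hf.const_smul c, fun E x hx => ?_⟩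
    · show (c • ξ E x)ᵀ = -(c • ξ E x)
      rw [Matrix.transpose_smul, h1 E x hx, smul_neg]
    · simp [h2 E x hx]

/-! ### The bilinear forms and matrices of the MSMFE-1 method -/

/-- A compliance tensor: a linear operator `A(x) : 𝕄 → 𝕄` at each point, symmetric, bounded and
uniformly positive definite. It is given element by element, so that it may jump across element
boundaries; `A E` is its restriction to the closed element `E`. -/
structure IsCompliance (A : M.Cell → Pt d → Tensor d →ₗ[ℝ] Tensor d) : Prop where
  symm : ∀ E : M.Cell, ∀ x ∈ E.carrier, ∀ σ τ : Tensor d,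
    ddot (A E x σ) τ = ddot σ (A E x τ)
  bounds : ∃ a₀ a₁ : ℝ, 0 < a₀ ∧ ∀ E : M.Cell, ∀ x ∈ E.carrier, ∀ τ : Tensor d,
    a₀ * ddot τ τ ≤ ddot (A E x τ) τ ∧ ddot (A E x τ) τ ≤ a₁ * ddot τ τ

/-- The vertex quadrature `(Aχ, τ)_Q` for the stress bilinear form. -/
noncomputable def stressForm (A : M.Cell → Pt d → Tensor d →ₗ[ℝ] Tensor d)
    (χ τ : M.BrokenP1) : ℝ :=
  ∑ E : M.Cell, E.vol / (d + 1) * ∑ r ∈ E.verts, ddot (A E r (χ E r)) (τ E r)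

/-- The vertex quadrature `(τ, ξ)_Q` for the stress-rotation bilinear form. -/
noncomputable def rotationForm (τ ξ : M.BrokenP1) : ℝ :=
  ∑ E : M.Cell, E.vol / (d + 1) * ∑ r ∈ E.verts, ddot (τ E r) (ξ E r)

/-- The row-wise divergence of an affine tensor field (a constant vector). -/
noncomputable def affineDiv (τ : Pt d →ᵃ[ℝ] Tensor d) : Fin d → ℝ :=
  fun i => ∑ j, (τ.linear (e j)) i j

/-- The form `(div τ, v)`. -/
noncomputable def divForm (τ : M.BrokenP1) (v : M.DisplacementSpace) : ℝ :=
  ∑ E : M.Cell, ∫ _x in E.carrier, ∑ i, affineDiv (τ E) i * v E i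

section matrices

variable {ισ ιu ιγ : Type*}

/-- `(A_σσ)_{ij} = (A τ_j, τ_i)_Q`. -/
noncomputable def matSS (A : M.Cell → Pt d → Tensor d →ₗ[ℝ] Tensor d)
    (τ : Module.Basis ισ ℝ M.stressSpace) : Matrix ισ ισ ℝ :=
  Matrix.of fun i j => M.stressForm A (τ j) (τ i)

/-- `(A_σu)_{ij} = (div τ_j, v_i)`. -/
noncomputable def matSU (τ : Module.Basis ισ ℝ M.stressSpace)
    (v : Module.Basis ιu ℝ M.DisplacementSpace) : Matrix ιu ισ ℝ :=
  Matrix.of fun i j => M.divForm (τ j) (v i)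

/-- `(A_σγ)_{ij} = (τ_j, ξ_i)_Q`. -/
noncomputable def matSG (τ : Module.Basis ισ ℝ M.stressSpace)
    (ξ : Module.Basis ιγ ℝ M.rotationSpace) : Matrix ιγ ισ ℝ :=
  Matrix.of fun i j => M.rotationForm (τ j) (ξ i)

variable [Fintype ισ] [DecidableEq ισ]

/-- The rotation matrix `A_σγ A_σσ⁻¹ A_σγᵀ`. -/
noncomputable def rotationMatrix (A : M.Cell → Pt d → Tensor d →ₗ[ℝ] Tensor d)
    (τ : Module.Basis ισ ℝ M.stressSpace) (ξ : Module.Basis ιγ ℝ M.rotationSpace) :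
    Matrix ιγ ιγ ℝ :=
  M.matSG τ ξ * (M.matSS A τ)⁻¹ * (M.matSG τ ξ)ᵀ

variable [Fintype ιγ] [DecidableEq ιγ]

/-- The displacement matrix
`A_σu A_σσ⁻¹ A_σuᵀ - A_σu A_σσ⁻¹ A_σγᵀ (A_σγ A_σσ⁻¹ A_σγᵀ)⁻¹ A_σγ A_σσ⁻¹ A_σuᵀ`. -/
noncomputable def displacementMatrix (A : M.Cell → Pt d → Tensor d →ₗ[ℝ] Tensor d)
    (τ : Module.Basis ισ ℝ M.stressSpace) (v : Module.Basis ιu ℝ M.DisplacementSpace)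
    (ξ : Module.Basis ιγ ℝ M.rotationSpace) : Matrix ιu ιu ℝ :=
  M.matSU τ v * (M.matSS A τ)⁻¹ * (M.matSU τ v)ᵀ
    - M.matSU τ v * (M.matSS A τ)⁻¹ * (M.matSG τ ξ)ᵀ * (M.rotationMatrix A τ ξ)⁻¹
      * (M.matSG τ ξ * (M.matSS A τ)⁻¹ * (M.matSU τ v)ᵀ)

end matrices

/-! ### The nodal bases -/

/-- `n F` is a unit normal to the facet `F`, for every facet (with any choice of orientation). -/
def IsUnitNormal (n : Finset (Pt d) → Pt d) : Prop :=
  ∀ F ∈ M.facets, ‖n F‖ = 1 ∧ ∀ r ∈ F, ∀ r' ∈ F, inner ℝ (n F) (r - r') = 0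

open Classical in
/-- The basis of `𝕏_h` dual to the degrees of freedom given by the components of the normal
stresses at the vertices of the facets: on every element `E`, for every facet `F` of `E` and every
vertex `r` of `F`, the value of `τ_q n_F` at `r` is `e_i` if `q = (F, r, i)` and `0` if the
facet or the vertex of `q` is a different one. -/
def IsNodalStressBasis (n : Finset (Pt d) → Pt d)
    (τ : Module.Basis M.StressDof ℝ M.stressSpace) : Prop :=
  ∀ (q : M.StressDof) (E : M.Cell), ∀ F ∈ M.facets, F ⊆ E.verts → ∀ r ∈ F,
    ((τ q : M.BrokenP1) E r) *ᵥ (n F : Fin d → ℝ) =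
      if q.1.1 = F ∧ q.1.2.1 = r then Pi.single q.1.2.2 1 else 0

end Mesh

/-- The isomorphism `Ξ : ℝ^{d(d-1)/2} → ℝ^{d × d}_skew` onto the skew-symmetric matrices, for `d = 2, 3`. -/
def Xi : (d : ℕ) → (Fin (d * (d - 1) / 2) → ℝ) → Tensor d
  | 2, p => !![0, p ⟨0, by decide⟩; -p ⟨0, by decide⟩, 0]
  | 3, p => !![0, -p ⟨2, by decide⟩, p ⟨1, by decide⟩;
               p ⟨2, by decide⟩, 0, -p ⟨0, by decide⟩;
               -p ⟨1, by decide⟩, p ⟨0, by decide⟩, 0]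
  | _, _ => 0

open Classical in
/-- The nodal (hat function) basis of `𝕎_h^1`: the basis function with index `(k, r)` has the value
`Ξ(e_k)` at the vertex `r` and vanishes at all other vertices. -/
def Mesh.IsNodalRotationBasis {d : ℕ} (M : Mesh d)
    (ξ : Module.Basis (Fin (d * (d - 1) / 2) × M.Vertex) ℝ M.rotationSpace) : Prop :=
  ∀ (k : Fin (d * (d - 1) / 2)) (r : M.Vertex) (E : M.Cell), ∀ r' ∈ E.verts,
    (ξ (k, r) : M.BrokenP1) E r' = if r' = r.1 then Xi d (Pi.single k 1) else 0

end MSMFE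

/-! Everything rests on two facts. First, the quadrature form of the compliance is positive
definite, because an affine field is determined by its vertex values (`stressForm_self_pos`).
Second, the transposes of the divergence and rotation matrices are jointly injective: if (div τ, v)
+ (τ, ξ)_Q = 0 for all stresses τ, then v = 0 and ξ = 0 (`eq_zero_of_divForm_add_rotationForm`).
Then C and S are both of the form Bᵀ A_σσ⁻¹ B with B injective, hence positive definite
(`posDef_schur_lower`, `posDef_schur_upper`), and the elimination is formal block Gauss elimination.

Joint injectivity comes from explicit test fields. On an element E with vertices a ≠ r, the field
|E|⁻¹ λ_r t ⊗ (a - r) has a normal trace only on the facet opposite a, and its outward trace there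
depends on that facet and r but not on E. So the difference of two such fields on neighbours is an
admissible stress (`pair_mem_stressSpace`), and on a Dirichlet facet one field suffices
(`single_mem_stressSpace`). With X the nodal values of ξ and a, a' the vertices opposite a common
facet of E and E', testing gives v_E' - v_E = (d+1)⁻¹ X(r)(a' - a) for every vertex r of the facet.
Hence X(r) - X(s) annihilates a' - a for all r, s in the facet.

Let the edge rs have an endpoint inside the domain. For d = 2 a nonzero skew matrix is invertible,
so X(r) = X(s). For d = 3 its kernel is a line, while the vectors a' - a around such an edge are
never all parallel (`exists_not_parallel`), so again X(r) = X(s). Every element has an interior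
vertex, so X is constant on each element, and then globally, since elements are linked through
facets (`eq_of_facet_adjacent`). At a Dirichlet facet the constant annihilates all edges of the
facet, so it is zero; then v has no jumps and vanishes next to that facet.

For nodal bases the vertex quadrature couples only degrees of freedom at the same vertex, so A_σσ,
its inverse and C are block-diagonal by vertices (`rotationMatrix_nodal`). -/

namespace MSMFE.Mesh

open scoped Classical

variable {d : ℕ} {M : Mesh d}

/-! ### Barycentric coordinates on an element -/

/-- The vertices of an element as an affine basis of `ℝ^d`. -/
noncomputable def Cell.basis (E : M.Cell) : AffineBasis E.verts ℝ (Pt d) where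
  toFun := Subtype.val
  ind' := M.complex.indep E.2.1
  tot' := by
    refine (M.complex.indep E.2.1).affineSpan_eq_top_iff_card_eq_finrank_add_one.2 ?_
    simpa using E.2.2

lemma Cell.basis_apply (E : M.Cell) (r : E.verts) : E.basis r = (r : Pt d) := rfl

/-- The barycentric coordinate of the element `E` that belongs to its vertex `r`. -/
noncomputable def Cell.bary (E : M.Cell) (r : Pt d) : Pt d →ᵃ[ℝ] ℝ :=
  -- The default 0 lets identities such as `Cell.bary_ne` hold without requiring `r` to be a vertex
  -- of `E`.
  if h : r ∈ E.verts then E.basis.coord ⟨r, h⟩ else 0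

lemma Cell.bary_of_mem {E : M.Cell} {r : Pt d} (h : r ∈ E.verts) :
    E.bary r = E.basis.coord ⟨r, h⟩ := dif_pos h

lemma Cell.bary_self {E : M.Cell} {r : Pt d} (h : r ∈ E.verts) : E.bary r r = 1 := by
  rw [Cell.bary_of_mem h]; exact E.basis.coord_apply_eq ⟨r, h⟩

lemma Cell.bary_ne {E : M.Cell} {r s : Pt d} (hs : s ∈ E.verts) (hrs : r ≠ s) :
    E.bary r s = 0 := by
  by_cases h : r ∈ E.verts
  · rw [Cell.bary_of_mem h]
    exact E.basis.coord_apply_ne (j := ⟨s, hs⟩) (fun h' => hrs (congrArg Subtype.val h'))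
  · simp [Cell.bary, h]

lemma Cell.sum_bary (E : M.Cell) (x : Pt d) : ∑ r ∈ E.verts, E.bary r x = 1 := by
  rw [← E.basis.sum_coord_apply_eq_one x, ← Finset.sum_coe_sort]
  exact Finset.sum_congr rfl fun r _ => by rw [Cell.bary_of_mem r.2]

lemma Cell.sum_bary_smul (E : M.Cell) (x : Pt d) : ∑ r ∈ E.verts, E.bary r x • r = x := by
  conv_rhs => rw [← E.basis.linear_combination_coord_eq_self x]
  rw [← Finset.sum_coe_sort]
  exact Finset.sum_congr rfl fun r _ => by rw [Cell.bary_of_mem r.2]; rfl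

lemma Cell.carrier_eq (E : M.Cell) : E.carrier = convexHull ℝ (Set.range E.basis) := by
  rw [Cell.carrier]
  congr 1
  ext x
  simp [Cell.basis_apply]

lemma Cell.mem_carrier_iff {E : M.Cell} {x : Pt d} :
    x ∈ E.carrier ↔ ∀ r ∈ E.verts, 0 ≤ E.bary r x := by
  rw [Cell.carrier_eq, E.basis.convexHull_eq_nonneg_coord]
  refine ⟨fun h r hr => by rw [Cell.bary_of_mem hr]; exact h _, fun h i => ?_⟩
  have := h i i.2
  rwa [Cell.bary_of_mem i.2] at this

lemma Cell.mem_interior_iff {E : M.Cell} {x : Pt d} :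
    x ∈ interior E.carrier ↔ ∀ r ∈ E.verts, 0 < E.bary r x := by
  rw [Cell.carrier_eq, E.basis.interior_convexHull]
  refine ⟨fun h r hr => by rw [Cell.bary_of_mem hr]; exact h _, fun h i => ?_⟩
  have := h i i.2
  rwa [Cell.bary_of_mem i.2] at this

lemma Cell.verts_subset_carrier (E : M.Cell) : (E.verts : Set (Pt d)) ⊆ E.carrier :=
  subset_convexHull ℝ _

lemma Cell.exists_mem_interior (E : M.Cell) : ∃ x, x ∈ interior E.carrier := by
  rw [Cell.carrier_eq]
  exact ⟨_, E.basis.centroid_mem_interior_convexHull⟩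

lemma Cell.convex_carrier (E : M.Cell) : Convex ℝ E.carrier := convex_convexHull ℝ _

lemma Cell.isCompact_carrier (E : M.Cell) : IsCompact E.carrier :=
  E.verts.finite_toSet.isCompact_convexHull (𝕜 := ℝ)

lemma Cell.vol_pos (E : M.Cell) : 0 < E.vol := by
  refine ENNReal.toReal_pos ?_ E.isCompact_carrier.measure_lt_top.ne
  obtain ⟨x, hx⟩ := E.exists_mem_interior
  exact ((isOpen_interior.measure_pos volume ⟨x, hx⟩).trans_le
    (measure_mono interior_subset)).ne'

/-- An affine map is determined by its values at the vertices of an element. -/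
lemma Cell.affineMap_ext {V : Type*} [AddCommGroup V] [Module ℝ V] (E : M.Cell)
    {f g : Pt d →ᵃ[ℝ] V} (h : ∀ r ∈ E.verts, f r = g r) : f = g := by
  refine AffineMap.ext_on (s := (E.verts : Set (Pt d))) ?_ fun r hr => h r hr
  have := E.basis.tot
  convert this
  ext x
  simp [Cell.basis_apply]

lemma Cell.bary_linear_sub (E : M.Cell) (r x y : Pt d) :
    (E.bary r).linear (x - y) = E.bary r x - E.bary r y :=
  (E.bary r).linearMap_vsub x y

lemma Cell.bary_add (E : M.Cell) (r x y : Pt d) :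
    E.bary r (x + y) = E.bary r x + (E.bary r).linear y := by
  rw [add_comm x y, add_comm (E.bary r x)]; exact (E.bary r).map_vadd x y

/-! ### Position of the elements in the mesh, neighbours across a facet -/

lemma Cell.carrier_subset_space (E : M.Cell) : E.carrier ⊆ M.complex.space :=
  Geometry.SimplicialComplex.convexHull_subset_space E.2.1

lemma Cell.interior_subset_domain (E : M.Cell) : interior E.carrier ⊆ M.domain :=
  interior_mono E.carrier_subset_space

lemma exists_cell_of_face {s : Finset (Pt d)} (hs : s ∈ M.complex.faces) :
    ∃ E : M.Cell, s ⊆ E.verts := by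
  obtain ⟨t, ht, hst, hc⟩ := M.pure s hs
  exact ⟨⟨t, ht, hc⟩, hst⟩

lemma exists_cell_of_mem_space {x : Pt d} (hx : x ∈ M.complex.space) :
    ∃ E : M.Cell, x ∈ E.carrier := by
  obtain ⟨s, hs, hx⟩ := Geometry.SimplicialComplex.mem_space_iff.1 hx
  obtain ⟨E, hE⟩ := exists_cell_of_face hs
  exact ⟨E, convexHull_mono (by exact_mod_cast hE) hx⟩

/-- An affine function that vanishes on a set vanishes on its convex hull. -/
lemma affine_eq_zero_of_mem_convexHull {f : Pt d →ᵃ[ℝ] ℝ} {s : Set (Pt d)}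
    (h : ∀ x ∈ s, f x = 0) {x : Pt d} (hx : x ∈ convexHull ℝ s) : f x = 0 := by
  have hc : Convex ℝ (f ⁻¹' {0}) := (convex_singleton (0 : ℝ)).affine_preimage f
  exact convexHull_min (fun y hy => h y hy) hc hx

lemma affine_nonneg_of_mem_convexHull {f : Pt d →ᵃ[ℝ] ℝ} {s : Set (Pt d)}
    (h : ∀ x ∈ s, 0 ≤ f x) {x : Pt d} (hx : x ∈ convexHull ℝ s) : 0 ≤ f x := by
  have hc : Convex ℝ (f ⁻¹' Set.Ici 0) := (convex_Ici (0 : ℝ)).affine_preimage f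
  exact convexHull_min (fun y hy => h y hy) hc hx

/-- If a point of the face of `E'` spanned by the vertices with positive coordinate lies in `E`, then these
vertices belong to `E`. -/
lemma Cell.mem_verts_of_bary_pos {E E' : M.Cell} {x : Pt d} (hx : x ∈ E.carrier)
    (hx' : x ∈ E'.carrier) {r : Pt d} (hr : 0 < E'.bary r x) : r ∈ E.verts := by
  by_contra hrE
  -- Conformity: the intersection lies in the hull of the common vertices, and the coordinate of `r`
  -- vanishes at each of these if `r` is not one of them.
  have h := M.complex.inter_subset_convexHull E.2.1 E'.2.1 ⟨hx, hx'⟩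
  refine hr.ne' (affine_eq_zero_of_mem_convexHull (fun y hy => ?_) h)
  refine Cell.bary_ne hy.2 ?_
  rintro rfl
  exact hrE hy.1

lemma Cell.card_verts (E : M.Cell) : E.verts.card = d + 1 := E.2.2

lemma Cell.ext_of_subset {E E' : M.Cell} (h : E.verts ⊆ E'.verts) : E = E' :=
  Subtype.ext (Finset.eq_of_subset_of_card_le h (E'.card_verts.trans E.card_verts.symm).le)

/-- From a point of the domain, a small step in any direction stays in one of the elements
that contain the point. -/
lemma exists_cell_direction {x : Pt d} (hx : x ∈ M.domain) (y : Pt d) :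
    ∃ E : M.Cell, x ∈ E.carrier ∧ ∃ ε : ℝ, 0 < ε ∧ x + ε • y ∈ E.carrier := by
  have hlim : Filter.Tendsto (fun n : ℕ => x + (1 / ((n : ℝ) + 1)) • y) Filter.atTop (nhds x) := by
    simpa using (tendsto_one_div_add_atTop_nhds_zero_nat (𝕜 := ℝ)).smul_const y |>.const_add x
  have hev : ∀ᶠ n : ℕ in Filter.atTop, ∃ E : M.Cell, x + (1 / ((n : ℝ) + 1)) • y ∈ E.carrier := by
    filter_upwards [hlim (isOpen_interior.mem_nhds hx)] with n hn
    exact exists_cell_of_mem_space (interior_subset hn)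
  -- There are finitely many elements, so one of them contains points of the sequence for infinitely
  -- many `n`; being closed, it also contains the limit `x`.
  have hfr : ∃ E : M.Cell, ∃ᶠ n : ℕ in Filter.atTop, x + (1 / ((n : ℝ) + 1)) • y ∈ E.carrier := by
    by_contra h
    simp only [not_exists, Filter.not_frequently] at h
    obtain ⟨n, ⟨E, hE⟩, hn⟩ := (hev.and (Filter.eventually_all.2 h)).exists
    exact hn E hE
  obtain ⟨E, hE⟩ := hfr
  refine ⟨E, ?_, ?_⟩
  · exact E.isCompact_carrier.isClosed.mem_of_frequently_of_tendsto hE hlim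
  · obtain ⟨n, hn⟩ := hE.exists
    exact ⟨_, by positivity, hn⟩

/-- Across the facet of `E` opposite to `a` there is another element, provided that the
facet contains a vertex in the interior of the domain. -/
lemma Cell.exists_neighbor {E : M.Cell} {a c : Pt d} (ha : a ∈ E.verts) (hc : c ∈ E.verts)
    (hac : a ≠ c) (hcd : c ∈ M.domain) :
    ∃ (E' : M.Cell) (a' : Pt d), a' ∈ E'.verts ∧ E'.verts.erase a' = E.verts.erase a ∧
      E.bary a a' < 0 := by
  obtain ⟨p, hp⟩ := E.exists_mem_interior
  rw [Cell.mem_interior_iff] at hp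
  -- An interior point of `E` is pushed parallel to the edge from `a` to `c` until its
  -- `a`-coordinate is zero: `z` lies in the relative interior of the facet.
  set z : Pt d := p - E.bary a p • (a - c) with hz
  have hbz : ∀ s, E.bary s z = E.bary s p - E.bary a p * (E.bary s a - E.bary s c) := by
    intro s
    rw [hz, sub_eq_add_neg, Cell.bary_add, map_neg, map_smul, Cell.bary_linear_sub, smul_eq_mul]
    ring
  have hza : E.bary a z = 0 := by
    rw [hbz, Cell.bary_self ha, Cell.bary_ne hc hac]; ring
  have hzs : ∀ s ∈ E.verts, s ≠ a → 0 < E.bary s z := by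
    intro s hs hsa
    rw [hbz, Cell.bary_ne ha hsa]
    have h1 := hp a ha
    have h2 := hp s hs
    by_cases hsc : s = c
    · subst hsc; rw [Cell.bary_self hs]; nlinarith
    · rw [Cell.bary_ne hc hsc]; nlinarith
  have hlim : Filter.Tendsto (fun δ : ℝ => c + δ • (z - c)) (nhdsWithin 0 (Set.Ioi 0)) (nhds c) := by
    have : Continuous fun δ : ℝ => c + δ • (z - c) := by fun_prop
    simpa using (this.tendsto 0).mono_left nhdsWithin_le_nhds
  obtain ⟨δ, hδd, hδ1, hδ0⟩ : ∃ δ : ℝ, c + δ • (z - c) ∈ M.domain ∧ δ < 1 ∧ 0 < δ := by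
    have h1 : ∀ᶠ δ : ℝ in nhdsWithin 0 (Set.Ioi 0), c + δ • (z - c) ∈ M.domain :=
      hlim (isOpen_interior.mem_nhds hcd)
    have h2 : ∀ᶠ δ : ℝ in nhdsWithin 0 (Set.Ioi 0), δ < 1 :=
      nhdsWithin_le_nhds (gt_mem_nhds one_pos)
    exact (h1.and (h2.and self_mem_nhdsWithin)).exists
  -- Shrinking towards `c` keeps the point in the relative interior of the facet and brings it into
  -- the domain.
  set x := c + δ • (z - c) with hx
  have hbx : ∀ s, E.bary s x = E.bary s c + δ * (E.bary s z - E.bary s c) := by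
    intro s
    rw [hx, Cell.bary_add, map_smul, Cell.bary_linear_sub, smul_eq_mul]
  have hxa : E.bary a x = 0 := by rw [hbx, hza, Cell.bary_ne hc hac]; ring
  have hxs : ∀ s ∈ E.verts, s ≠ a → 0 < E.bary s x := by
    intro s hs hsa
    have h1 := hzs s hs hsa
    rw [hbx]
    by_cases hsc : s = c
    · subst hsc; rw [Cell.bary_self hs] at *; nlinarith
    · rw [Cell.bary_ne hc hsc]; nlinarith
  have hxE : x ∈ E.carrier := Cell.mem_carrier_iff.2 fun s hs => by
    by_cases hsa : s = a
    · rw [hsa, hxa]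
    · exact (hxs s hs hsa).le
  -- The direction `c - a` leaves `E`. The element entered contains `x`, hence all vertices of the
  -- facet, and it has a vertex with negative `a`-coordinate, because one of its points does.
  obtain ⟨E', hxE', ε, hε, hy⟩ := exists_cell_direction hδd (c - a)
  have hsub : E.verts.erase a ⊆ E'.verts := fun s hs =>
    Cell.mem_verts_of_bary_pos hxE' hxE (hxs s (Finset.mem_of_mem_erase hs)
      (Finset.ne_of_mem_erase hs))
  have hneg : E.bary a (x + ε • (c - a)) < 0 := by
    rw [Cell.bary_add, map_smul, Cell.bary_linear_sub, hxa, Cell.bary_self ha,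
      Cell.bary_ne hc hac, smul_eq_mul]
    linarith
  obtain ⟨a', ha', hneg'⟩ : ∃ a' ∈ E'.verts, E.bary a a' < 0 := by
    by_contra! h
    exact absurd (affine_nonneg_of_mem_convexHull (fun r hr => h r hr) hy) (not_le.2 hneg)
  have ha'E : a' ∉ E.verts.erase a := fun h => by
    rw [Cell.bary_ne (Finset.mem_of_mem_erase h) (Finset.ne_of_mem_erase h).symm] at hneg'
    exact lt_irrefl _ hneg'
  refine ⟨E', a', ha', ?_, hneg'⟩
  symm
  refine Finset.eq_of_subset_of_card_le (fun s hs => ?_) ?_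
  · exact Finset.mem_erase.2 ⟨fun h => ha'E (h ▸ hs), hsub hs⟩
  · rw [Finset.card_erase_of_mem ha, Finset.card_erase_of_mem ha', E.card_verts,
      E'.card_verts]

end MSMFE.Mesh

namespace MSMFE

/-! ### Skew-symmetric matrices with a large kernel -/

lemma skew_apply {d : ℕ} {N : Tensor d} (hN : Nᵀ = -N) (i j : Fin d) : N j i = -N i j :=
  congrFun (congrFun hN i) j

/-- Such a matrix is a multiple of the rotation by a right angle, hence invertible unless it is
zero. -/
lemma skew_eq_zero_two {N : Tensor 2} (hN : Nᵀ = -N) {w : Fin 2 → ℝ} (hw : w ≠ 0)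
    (h : N *ᵥ w = 0) : N = 0 := by
  have h00 := skew_apply hN 0 0
  have h11 := skew_apply hN 1 1
  have h01 := skew_apply hN 0 1
  have e0 : N 0 0 = 0 := by linarith
  have e1 : N 1 1 = 0 := by linarith
  have k0 := congrFun h 0
  have k1 := congrFun h 1
  simp only [Matrix.mulVec, dotProduct, Fin.sum_univ_two, Pi.zero_apply, e0, e1, h01, zero_mul,
    zero_add, add_zero] at k0 k1
  have : N 0 1 = 0 := by
    by_contra hne
    refine hw (funext fun i => ?_)
    fin_cases i
    · simpa [hne] using k1
    · simpa [hne] using k0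
  ext i j
  fin_cases i <;> fin_cases j <;> simp [e0, e1, h01, this]

/-- The witness is the axial vector of `N`, which spans the kernel. The cases only select a nonzero
component of it by which to divide. -/
lemma skew_ker_three {N : Tensor 3} (hN : Nᵀ = -N) (h0 : N ≠ 0) :
    ∃ q : Fin 3 → ℝ, ∀ w : Fin 3 → ℝ, N *ᵥ w = 0 → ∃ μ : ℝ, w = μ • q := by
  have d0 : N 0 0 = 0 := by linarith [skew_apply hN 0 0]
  have d1 : N 1 1 = 0 := by linarith [skew_apply hN 1 1]
  have d2 : N 2 2 = 0 := by linarith [skew_apply hN 2 2]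
  have h01 := skew_apply hN 0 1
  have h02 := skew_apply hN 0 2
  have h12 := skew_apply hN 1 2
  refine ⟨![N 1 2, - N 0 2, N 0 1], fun w hw => ?_⟩
  have k0 := congrFun hw 0
  have k1 := congrFun hw 1
  have k2 := congrFun hw 2
  simp only [Matrix.mulVec, dotProduct, Fin.sum_univ_three, Pi.zero_apply, d0, d1, d2, h01, h02,
    h12, zero_mul, zero_add, add_zero] at k0 k1 k2
  by_cases a : N 0 1 = 0
  · by_cases b : N 0 2 = 0
    · have c : N 1 2 ≠ 0 := by
        intro c
        refine h0 ?_
        ext i j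
        fin_cases i <;> fin_cases j <;> simp [d0, d1, d2, h01, h02, h12, a, b, c]
      refine ⟨w 0 / N 1 2, funext fun i => ?_⟩
      simp only [a, b, neg_zero, zero_mul, zero_add] at k0 k1 k2
      have w2 : w 2 = 0 := by simpa [c] using k1
      have w1 : w 1 = 0 := by simpa [c] using k2
      fin_cases i <;> simp [a, b, c, w1, w2]
    · refine ⟨- w 1 / N 0 2, funext fun i => ?_⟩
      fin_cases i <;> simp <;> field_simp <;> linarith
  · refine ⟨w 2 / N 0 1, funext fun i => ?_⟩
    fin_cases i <;> simp <;> field_simp <;> linarith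

/-- A skew-symmetric matrix whose kernel has codimension at most one vanishes. -/
lemma skew_eq_zero_of_ker {d : ℕ} {N : Tensor d} (hN : Nᵀ = -N) (u : Fin d → ℝ)
    (h : ∀ y, ∃ c : ℝ, N *ᵥ y = c • (N *ᵥ u)) : N = 0 := by
  have hs : ∀ x y : Fin d → ℝ, x ⬝ᵥ (N *ᵥ y) = - (y ⬝ᵥ (N *ᵥ x)) := by
    intro x y
    rw [Matrix.dotProduct_mulVec, ← Matrix.mulVec_transpose, hN, Matrix.neg_mulVec,
      neg_dotProduct, dotProduct_comm]
  -- The range of `N` is spanned by `N u`, and skewness gives y · N u = - u · N y = - c (u · N u) =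
  -- 0.
  have hu : N *ᵥ u = 0 := by
    refine dotProduct_eq_zero _ fun y => ?_
    obtain ⟨c, hc⟩ := h y
    rw [dotProduct_comm, hs, hc, dotProduct_smul]
    have := hs u u
    have h0 : u ⬝ᵥ (N *ᵥ u) = 0 := by linarith
    rw [h0, smul_zero, neg_zero]
  have : ∀ y, N *ᵥ y = 0 := fun y => by
    obtain ⟨c, hc⟩ := h y
    rw [hc, hu, smul_zero]
  exact Matrix.ext_of_mulVec_single fun i => by rw [this, Matrix.zero_mulVec]

namespace Mesh

open scoped Classical

variable {d : ℕ} {M : Mesh d}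

lemma ofLp_sub_mulVec (N : Tensor d) (x y : Pt d) :
    N *ᵥ (x - y).ofLp = N *ᵥ x.ofLp - N *ᵥ y.ofLp := by
  rw [WithLp.ofLp_sub, Matrix.mulVec_sub]

/-- A skew-symmetric matrix that annihilates the edges of a facet vanishes. -/
lemma Cell.skew_eq_zero {E : M.Cell} {N : Tensor d} (hN : Nᵀ = -N) {a r : Pt d}
    (h : ∀ s ∈ E.verts.erase a, N *ᵥ (s - r).ofLp = 0) : N = 0 := by
  -- Expanding `y` in the edge vectors `s - r` with differences of barycentric coordinates, only the
  -- term of `a` survives under `N`. If `a` is not a vertex, its coordinate is 0 by default and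
  -- nothing survives.
  refine skew_eq_zero_of_ker hN (a - r).ofLp fun y => ⟨E.bary a (r + WithLp.toLp 2 y), ?_⟩
  set x : Pt d := r + WithLp.toLp 2 y with hx
  have hy : y = (x - r).ofLp := by simp [hx]
  have hxr : x - r = ∑ s ∈ E.verts, E.bary s x • (s - r) := by
    simp only [smul_sub, Finset.sum_sub_distrib, ← Finset.sum_smul]
    rw [E.sum_bary_smul, E.sum_bary, one_smul]
  have hsum : N *ᵥ (x - r).ofLp = ∑ s ∈ E.verts, E.bary s x • (N *ᵥ (s - r).ofLp) := by
    conv_lhs => rw [hxr]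
    rw [WithLp.ofLp_sum, ← Matrix.mulVecLin_apply, map_sum]
    exact Finset.sum_congr rfl fun s _ => by
      rw [Matrix.mulVecLin_apply, WithLp.ofLp_smul, Matrix.mulVec_smul]
  rw [hy, hsum]
  refine Finset.sum_eq_single a (fun s hs hsa => ?_) fun ha => ?_
  · rw [h s (Finset.mem_erase.2 ⟨hsa, hs⟩), smul_zero]
  · rw [Cell.bary, dif_neg ha]; simp

/-! ### Elements around an interior edge -/

/-- Change of barycentric coordinates across a common facet: both sides are affine and agree at the
vertices of `E'`. -/
lemma Cell.bary_eq_add {E E' : M.Cell} {s s' : Pt d} (hs' : s' ∈ E'.verts)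
    (he : E'.verts.erase s' = E.verts.erase s) {x : Pt d} (hx : x ∈ E.verts.erase s) (y : Pt d) :
    E.bary x y = E'.bary x y + E.bary x s' * E'.bary s' y := by
  have h : E.bary x = E'.bary x + E.bary x s' • E'.bary s' := by
    refine E'.affineMap_ext fun r hr => ?_
    have hx' := he ▸ hx
    simp only [AffineMap.coe_add, Pi.add_apply, AffineMap.coe_smul, Pi.smul_apply, smul_eq_mul]
    by_cases hrs : r = s'
    · subst hrs
      rw [Cell.bary_self hs', Cell.bary_ne hs' (Finset.ne_of_mem_erase hx')]
      ring
    · have hr' : r ∈ E.verts.erase s := he ▸ Finset.mem_erase.2 ⟨hrs, hr⟩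
      rw [Cell.bary_ne hr (Ne.symm hrs)]
      by_cases hxr : x = r
      · subst hxr
        rw [Cell.bary_self (Finset.mem_of_mem_erase hr'), Cell.bary_self hr]; ring
      · rw [Cell.bary_ne (Finset.mem_of_mem_erase hr') hxr, Cell.bary_ne hr hxr]; ring
  conv_lhs => rw [h]
  simp only [AffineMap.coe_add, Pi.add_apply, AffineMap.coe_smul, Pi.smul_apply, smul_eq_mul]

/-- Both coordinates vanish on the common facet, so they are proportional; the factor is read off at
`s'`. -/
lemma Cell.bary_eq_mul {E E' : M.Cell} {s s' : Pt d} (hs' : s' ∈ E'.verts)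
    (he : E'.verts.erase s' = E.verts.erase s) (y : Pt d) :
    E.bary s y = E.bary s s' * E'.bary s' y := by
  have h : E.bary s = E.bary s s' • E'.bary s' := by
    refine E'.affineMap_ext fun r hr => ?_
    simp only [AffineMap.coe_smul, Pi.smul_apply, smul_eq_mul]
    by_cases hrs : r = s'
    · subst hrs; rw [Cell.bary_self hs']; ring
    · have hr' : r ∈ E.verts.erase s := he ▸ Finset.mem_erase.2 ⟨hrs, hr⟩
      rw [Cell.bary_ne hr (Ne.symm hrs), Cell.bary_ne (Finset.mem_of_mem_erase hr')
        (Finset.ne_of_mem_erase hr').symm, mul_zero]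
  conv_lhs => rw [h]
  simp only [AffineMap.coe_smul, Pi.smul_apply, smul_eq_mul]

lemma Cell.bary_sub_smul (E : M.Cell) (x m q : Pt d) (η : ℝ) :
    E.bary x (m - η • q) = E.bary x m - η * (E.bary x).linear q := by
  rw [sub_eq_add_neg, Cell.bary_add, map_neg, map_smul, smul_eq_mul]; ring

/-- The neighbor of `E` across the facet opposite to `s`, in the case that the two opposite
vertices differ by a multiple of `q`, where the ray from `m` in direction `q` runs into the interior of `E`:
it contains the opposite ray. -/
lemma Cell.neighbor_mem {E E' : M.Cell} {s s' m q : Pt d} (hs : s ∈ E.verts) (hs' : s' ∈ E'.verts)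
    (he : E'.verts.erase s' = E.verts.erase s) (hneg : E.bary s s' < 0) {μ : ℝ}
    (hμ : s' - s = μ • q) (hm : m ∈ E.carrier)
    (hpos : ∀ x ∈ E.verts, E.bary x m = 0 → 0 < (E.bary x).linear q) (hsm : E.bary s m = 0) :
    ∀ᶠ η : ℝ in nhdsWithin 0 (Set.Ioi 0), ∀ x ∈ E'.verts, 0 < E'.bary x (m - η • q) := by
  have hκ := hpos s hs hsm
  set κ := (E.bary s).linear q with hκd
  have hlin : ∀ x, E.bary x s' = E.bary x s + μ * (E.bary x).linear q := by
    intro x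
    have : s' = s + μ • q := by rw [← hμ]; abel
    rw [this, Cell.bary_add, map_smul, smul_eq_mul]
  have hss : E.bary s s' = 1 + μ * κ := by rw [hlin, Cell.bary_self hs]
  -- This number is the `s`-coordinate of `s'`. Its sign reverses the direction `q` in the
  -- coordinate formulas of `E'` below.
  have hD : 1 + μ * κ < 0 := hss ▸ hneg
  have hs'y : ∀ η : ℝ, E'.bary s' (m - η • q) = η * κ / (-(1 + μ * κ)) := by
    intro η
    have h1 := Cell.bary_eq_mul hs' he (m - η • q)
    rw [Cell.bary_sub_smul, hsm, hss, ← hκd] at h1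
    rw [eq_div_iff (by linarith)]
    linarith
  rw [Filter.eventually_all_finset]
  intro x hx
  by_cases hxs : x = s'
  · subst hxs
    filter_upwards [self_mem_nhdsWithin] with η hη
    rw [hs'y]
    exact div_pos (mul_pos hη hκ) (by linarith)
  · have hxE : x ∈ E.verts.erase s := he ▸ Finset.mem_erase.2 ⟨hxs, hx⟩
    have hxE' := Finset.mem_of_mem_erase hxE
    have hform : ∀ η : ℝ, E'.bary x (m - η • q) =
        E.bary x m - η * ((E.bary x).linear q / (1 + μ * κ)) := by
      intro η
      have h1 := Cell.bary_eq_add hs' he hxE (m - η • q)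
      rw [hs'y, Cell.bary_sub_smul, hlin, Cell.bary_ne hs (Finset.ne_of_mem_erase hxE)] at h1
      have : 1 + μ * κ ≠ 0 := hD.ne
      field_simp at h1 ⊢
      linarith
    simp only [hform]
    -- A coordinate that vanishes at `m` grows along `-q` by the sign of `1 + μ * κ`; one that is
    -- positive at `m` stays positive for small `η`.
    rcases (Cell.mem_carrier_iff.1 hm x hxE').eq_or_lt with h0 | h0
    · filter_upwards [self_mem_nhdsWithin] with η hη
      rw [← h0, zero_sub, neg_pos]
      exact mul_neg_of_pos_of_neg hη (div_neg_of_pos_of_neg (hpos x hxE' h0.symm) hD)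
    · have hc : Continuous fun η : ℝ => E.bary x m - η * ((E.bary x).linear q / (1 + μ * κ)) := by
        fun_prop
      have := (hc.tendsto 0).mono_left (nhdsWithin_le_nhds (s := Set.Ioi (0 : ℝ)))
      simp only [zero_mul, sub_zero] at this
      exact this.eventually (lt_mem_nhds h0)

/-- The opposite vertices of the elements across the facets around an interior edge are not all aligned in one direction (in dimension at least three). -/
lemma exists_not_parallel (hd : 3 ≤ d) {E₀ : M.Cell} {c r : Pt d} (hc : c ∈ E₀.verts)
    (hr : r ∈ E₀.verts) (hcr : c ≠ r) (hcd : c ∈ M.domain) (q : Pt d) :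
    ∃ (E E' : M.Cell) (s s' : Pt d), s ∈ E.verts ∧ s' ∈ E'.verts ∧
      E'.verts.erase s' = E.verts.erase s ∧ c ∈ E.verts.erase s ∧ r ∈ E.verts.erase s ∧
      E.bary s s' < 0 ∧ ∀ μ : ℝ, s' - s ≠ μ • q := by
  by_contra! hpar
  have hlim : Filter.Tendsto (fun δ : ℝ => c + δ • (r - c)) (nhdsWithin 0 (Set.Ioi 0)) (nhds c) := by
    have : Continuous fun δ : ℝ => c + δ • (r - c) := by fun_prop
    simpa using (this.tendsto 0).mono_left nhdsWithin_le_nhds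
  obtain ⟨δ, hδd, hδ1, hδ0⟩ : ∃ δ : ℝ, c + δ • (r - c) ∈ M.domain ∧ δ < 1 ∧ 0 < δ := by
    have h1 : ∀ᶠ δ : ℝ in nhdsWithin 0 (Set.Ioi 0), c + δ • (r - c) ∈ M.domain :=
      hlim (isOpen_interior.mem_nhds hcd)
    have h2 : ∀ᶠ δ : ℝ in nhdsWithin 0 (Set.Ioi 0), δ < 1 :=
      nhdsWithin_le_nhds (gt_mem_nhds one_pos)
    exact (h1.and (h2.and self_mem_nhdsWithin)).exists
  -- A point in the open edge from `c` to `r`, close enough to `c` to lie in the domain.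
  set m := c + δ • (r - c) with hmd
  have hbm : ∀ (E : M.Cell) (s : Pt d), E.bary s m =
      E.bary s c + δ * (E.bary s r - E.bary s c) := by
    intro E s
    rw [hmd, Cell.bary_add, map_smul, Cell.bary_linear_sub, smul_eq_mul]
  have hbmc : ∀ (E : M.Cell), c ∈ E.verts → r ∈ E.verts → 0 < E.bary c m := by
    intro E h1 h2
    rw [hbm, Cell.bary_self h1, Cell.bary_ne h2 hcr]; linarith
  have hbmr : ∀ (E : M.Cell), c ∈ E.verts → r ∈ E.verts → 0 < E.bary r m := by
    intro E h1 h2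
    rw [hbm, Cell.bary_self h2, Cell.bary_ne h1 hcr.symm]; linarith
  have hbms : ∀ (E : M.Cell), c ∈ E.verts → r ∈ E.verts → ∀ s, s ≠ c → s ≠ r →
      E.bary s m = 0 := by
    intro E h1 h2 s h3 h4
    rw [hbm, Cell.bary_ne h1 h3, Cell.bary_ne h2 h4]; ring
  have hm₀ : m ∈ E₀.carrier := Cell.mem_carrier_iff.2 fun s _ => by
    by_cases h1 : s = c
    · exact h1 ▸ (hbmc E₀ hc hr).le
    · by_cases h2 : s = r
      · exact h2 ▸ (hbmr E₀ hc hr).le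
      · exact (hbms E₀ hc hr s h1 h2).ge
  -- `E` is the element entered from `m` in direction `q`. It contains the edge, since both edge
  -- coordinates are positive at `m`.
  obtain ⟨E, hmE, ε, hε, hqE⟩ := exists_cell_direction hδd q
  have hcE := Cell.mem_verts_of_bary_pos hmE hm₀ (hbmc E₀ hc hr)
  have hrE := Cell.mem_verts_of_bary_pos hmE hm₀ (hbmr E₀ hc hr)
  have hnb : ∀ s ∈ E.verts, s ≠ c → s ≠ r → ∃ (E' : M.Cell) (s' : Pt d), s' ∈ E'.verts ∧
      E'.verts.erase s' = E.verts.erase s ∧ E.bary s s' < 0 ∧ ∃ μ : ℝ, s' - s = μ • q := by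
    intro s hs hsc hsr
    obtain ⟨E', s', hs', he, hneg⟩ := Cell.exists_neighbor hs hcE hsc hcd
    exact ⟨E', s', hs', he, hneg, hpar E E' s s' hs hs' he
      (Finset.mem_erase.2 ⟨hsc.symm, hcE⟩) (Finset.mem_erase.2 ⟨hsr.symm, hrE⟩) hneg⟩
  -- The derivative is nonnegative because the ray enters `E`. Were it zero, moving from `x` by a
  -- multiple of `q` would leave the `x`-coordinate equal to 1, but it is negative at `x'`.
  have hpos : ∀ x ∈ E.verts, E.bary x m = 0 → 0 < (E.bary x).linear q := by
    intro x hx hxm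
    have hxc : x ≠ c := fun h => (hbmc E hcE hrE).ne' (h ▸ hxm)
    have hxr : x ≠ r := fun h => (hbmr E hcE hrE).ne' (h ▸ hxm)
    obtain ⟨E', x', hx', he, hneg, μ, hμ⟩ := hnb x hx hxc hxr
    have h1 := Cell.mem_carrier_iff.1 hqE x hx
    rw [Cell.bary_add, hxm, map_smul, smul_eq_mul, zero_add] at h1
    have h2 : 0 ≤ (E.bary x).linear q := nonneg_of_mul_nonneg_right h1 hε
    refine h2.lt_of_ne fun h0 => ?_
    have : x' = x + μ • q := by rw [← hμ]; abel
    rw [this, Cell.bary_add, Cell.bary_self hx, map_smul, ← h0, smul_zero] at hneg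
    linarith
  -- Here `3 ≤ d` is needed: besides `c` and `r` there are `d - 1 ≥ 2` vertices.
  obtain ⟨s, hs, t, ht, hst⟩ : ∃ s ∈ (E.verts.erase c).erase r,
      ∃ t ∈ (E.verts.erase c).erase r, s ≠ t := by
    refine Finset.one_lt_card.1 ?_
    rw [Finset.card_erase_of_mem (Finset.mem_erase.2 ⟨hcr.symm, hrE⟩),
      Finset.card_erase_of_mem hcE, E.card_verts]
    omega
  simp only [Finset.mem_erase] at hs ht
  obtain ⟨E₁, s', hs', he1, hneg1, μ, hμ⟩ := hnb s hs.2.2 hs.2.1 hs.1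
  obtain ⟨E₂, t', ht', he2, hneg2, ν, hν⟩ := hnb t ht.2.2 ht.2.1 ht.1
  have h1 := Cell.neighbor_mem hs.2.2 hs' he1 hneg1 hμ hmE hpos (hbms E hcE hrE s hs.2.1 hs.1)
  have h2 := Cell.neighbor_mem ht.2.2 ht' he2 hneg2 hν hmE hpos (hbms E hcE hrE t ht.2.1 ht.1)
  -- The neighbours across two different facets have a common interior point `m - η q`, hence
  -- coincide. Then `t` belongs to the neighbour across its own opposite facet, which forces `t =
  -- t'` and contradicts the sign of the coordinate of `t'`.
  obtain ⟨η, hη1, hη2⟩ := (h1.and h2).exists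
  have h12 : E₁.verts ⊆ E₂.verts := fun x hx =>
    Cell.mem_verts_of_bary_pos (Cell.mem_carrier_iff.2 fun y hy => (hη2 y hy).le)
      (Cell.mem_carrier_iff.2 fun y hy => (hη1 y hy).le) (hη1 x hx)
  have htE : t ∈ E₁.verts.erase s' := he1 ▸ Finset.mem_erase.2 ⟨hst.symm, ht.2.2⟩
  have htE2 := h12 (Finset.mem_of_mem_erase htE)
  have htt : t = t' := by
    by_contra h
    have : t ∈ E.verts.erase t := he2 ▸ Finset.mem_erase.2 ⟨h, htE2⟩
    exact Finset.ne_of_mem_erase this rfl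
  rw [← htt, Cell.bary_self ht.2.2] at hneg2
  linarith

/-- Skew-symmetric nodal values whose jumps along the edges of each interior facet annihilate the vector
between the two opposite vertices agree along all edges from interior vertices. -/
lemma skew_eq_of_edge (hd : d = 2 ∨ d = 3) {X : Pt d → Tensor d}
    (hskew : ∀ r ∈ M.complex.vertices, (X r)ᵀ = -X r)
    (hX : ∀ (E E' : M.Cell) (a a' : Pt d), a ∈ E.verts → a' ∈ E'.verts →
      E'.verts.erase a' = E.verts.erase a → E ≠ E' → ∀ r ∈ E.verts.erase a,
      ∀ s ∈ E.verts.erase a, (X r - X s) *ᵥ (a' - a).ofLp = 0)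
    {E : M.Cell} {c r : Pt d} (hc : c ∈ E.verts) (hr : r ∈ E.verts) (hcd : c ∈ M.domain) :
    X r = X c := by
  by_cases hcr : c = r
  · rw [hcr]
  have hv : ∀ x ∈ E.verts, x ∈ M.complex.vertices := fun x hx =>
    M.complex.down_closed E.2.1 (Finset.singleton_subset_iff.2 hx) (Finset.singleton_nonempty _)
  have hNs : (X c - X r)ᵀ = -(X c - X r) := by
    rw [Matrix.transpose_sub, hskew c (hv c hc), hskew r (hv r hr)]; abel
  have hne : ∀ {E E' : M.Cell} {s s' : Pt d}, s ∈ E.verts → E'.verts.erase s' = E.verts.erase s →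
      s' ∈ E'.verts → E.bary s s' < 0 → E ≠ E' := by
    rintro E E' s s' hs he hs' hneg rfl
    exact absurd (Cell.mem_carrier_iff.1 (E.verts_subset_carrier hs') s hs) (not_le.2 hneg)
  rw [eq_comm, ← sub_eq_zero]
  rcases hd with rfl | rfl
  -- In the plane the edge is itself a facet, and the single jump across it suffices.
  · obtain ⟨s, hs⟩ : ((E.verts.erase c).erase r).Nonempty := by
      rw [← Finset.card_pos, Finset.card_erase_of_mem (Finset.mem_erase.2 ⟨Ne.symm hcr, hr⟩),
        Finset.card_erase_of_mem hc, E.card_verts]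
      norm_num
    simp only [Finset.mem_erase] at hs
    obtain ⟨E', s', hs', he, hneg⟩ := Cell.exists_neighbor hs.2.2 hc hs.2.1 hcd
    refine skew_eq_zero_two hNs (w := (s' - s).ofLp) (fun h0 => ?_)
      (hX E E' s s' hs.2.2 hs' he (hne hs.2.2 he hs' hneg) c
        (Finset.mem_erase.2 ⟨hs.2.1.symm, hc⟩) r (Finset.mem_erase.2 ⟨hs.1.symm, hr⟩))
    have : s' = s := sub_eq_zero.1 (by ext i; exact congrFun h0 i)
    rw [this, Cell.bary_self hs.2.2] at hneg
    linarith
  -- In space a nonzero jump would have a kernel spanned by one `q`, making all differences of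
  -- opposite vertices around the edge parallel to `q`.
  · by_contra hN
    obtain ⟨q, hq⟩ := skew_ker_three hNs hN
    obtain ⟨E₁, E₂, s, s', hs, hs', he, hcs, hrs, hneg, hnp⟩ :=
      exists_not_parallel le_rfl hc hr hcr hcd (WithLp.toLp 2 q)
    obtain ⟨μ, hμ⟩ := hq _ (hX E₁ E₂ s s' hs hs' he (hne hs he hs' hneg) c hcs r hrs)
    exact hnp μ (by ext i; exact congrFun hμ i)

end Mesh
end MSMFE

namespace MSMFE.Mesh

open scoped Classical

variable {d : ℕ} {M : Mesh d}

/-! ### The elements are connected through facets -/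

lemma affineSpan_ne_top_of_card_le {s : Finset (Pt d)} (h : s.card ≤ d) :
    affineSpan ℝ (s : Set (Pt d)) ≠ ⊤ := by
  intro htop
  have hne : s.Nonempty := by
    rw [Finset.nonempty_iff_ne_empty]
    rintro rfl
    simp at htop
  have hpos := hne.card_pos
  have h1 := finrank_vectorSpan_image_finset_le ℝ (id : Pt d → Pt d) s (n := s.card - 1) (by omega)
  rw [Finset.image_id, ← direction_affineSpan, htop, AffineSubspace.direction_top, finrank_top,
    finrank_euclideanSpace_fin] at h1
  omega

lemma Cell.exists_erase_eq {E E' : M.Cell} (h : (E.verts ∩ E'.verts).card = d) :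
    ∃ a ∈ E.verts, ∃ a' ∈ E'.verts, E'.verts.erase a' = E.verts.erase a := by
  have key : ∀ s t : Finset (Pt d), s.card = d + 1 → (s ∩ t).card = d →
      ∃ a ∈ s, s.erase a = s ∩ t := by
    intro s t hs hst
    have h1 : (s \ t).card = 1 := by
      have := Finset.card_sdiff_add_card_inter s t
      omega
    obtain ⟨a, ha⟩ := Finset.card_eq_one.1 h1
    have haS : a ∈ s \ t := ha ▸ Finset.mem_singleton_self a
    refine ⟨a, (Finset.mem_sdiff.1 haS).1, ?_⟩
    rw [← Finset.sdiff_singleton_eq_erase, ← ha, sdiff_sdiff_right_self]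
    rfl
  obtain ⟨a, ha, h1⟩ := key _ _ E.card_verts h
  obtain ⟨a', ha', h2⟩ := key _ _ E'.card_verts (by rwa [Finset.inter_comm])
  exact ⟨a, ha, a', ha', by rw [h1, h2, Finset.inter_comm]⟩

lemma Cell.card_inter_le {E E' : M.Cell} (h : E ≠ E') : (E.verts ∩ E'.verts).card ≤ d := by
  by_contra! hlt
  refine h (Cell.ext_of_subset fun x hx => ?_)
  have : E.verts ∩ E'.verts = E.verts :=
    Finset.eq_of_subset_of_card_le Finset.inter_subset_left (by rw [E.card_verts]; omega)
  rw [← this] at hx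
  exact Finset.mem_of_mem_inter_right hx

/-- The elements with the value `f E` and those with other values form two closed sets, by
finiteness, that cover `S`. A preconnected `S` meeting both meets their intersection, where `hf`
gives a contradiction. -/
lemma eq_on_preconnected {α : Type*} {f : M.Cell → α} {S : Set (Pt d)} (hS : IsPreconnected S)
    (hcov : S ⊆ M.complex.space)
    (hf : ∀ E E' : M.Cell, ∀ x ∈ S, x ∈ E.carrier → x ∈ E'.carrier → f E = f E')
    {E E' : M.Cell} (hE : (S ∩ E.carrier).Nonempty) (hE' : (S ∩ E'.carrier).Nonempty) :
    f E = f E' := by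
  by_contra hne
  have hcl : ∀ p : M.Cell → Prop, IsClosed (⋃ (K : M.Cell) (_ : p K), K.carrier) := fun p =>
    isClosed_iUnion_of_finite fun K => isClosed_iUnion_of_finite fun _ =>
      K.isCompact_carrier.isClosed
  obtain ⟨x, hx, hx1, hx2⟩ := isPreconnected_closed_iff.1 hS _ _ (hcl fun K => f K = f E)
    (hcl fun K => f K ≠ f E) (fun x hx => by
      obtain ⟨K, hK⟩ := exists_cell_of_mem_space (hcov hx)
      by_cases h : f K = f E
      · exact Or.inl (Set.mem_iUnion₂.2 ⟨K, h, hK⟩)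
      · exact Or.inr (Set.mem_iUnion₂.2 ⟨K, h, hK⟩))
    (by obtain ⟨x, hx, hxE⟩ := hE; exact ⟨x, hx, Set.mem_iUnion₂.2 ⟨E, rfl, hxE⟩⟩)
    (by obtain ⟨x, hx, hxE⟩ := hE'; exact ⟨x, hx, Set.mem_iUnion₂.2 ⟨E', Ne.symm hne, hxE⟩⟩)
  obtain ⟨K, hK, hxK⟩ := Set.mem_iUnion₂.1 hx1
  obtain ⟨K', hK', hxK'⟩ := Set.mem_iUnion₂.1 hx2
  exact hK' ((hf K' K x hx hxK' hxK).trans hK)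

/-- A function on the elements that takes equal values on elements with a common facet is
constant. -/
theorem eq_of_facet_adjacent {α : Type*} {f : M.Cell → α}
    (hf : ∀ (E E' : M.Cell) (a a' : Pt d), a ∈ E.verts → a' ∈ E'.verts →
      E'.verts.erase a' = E.verts.erase a → E ≠ E' → f E = f E') (E₀ E₁ : M.Cell) :
    f E₀ = f E₁ := by
  have hint : ∀ E : M.Cell, (M.domain ∩ E.carrier).Nonempty := fun E => by
    obtain ⟨x, hx⟩ := E.exists_mem_interior
    exact ⟨x, E.interior_subset_domain hx, interior_subset hx⟩
  -- Connectedness of the domain reduces the claim to two elements that share a point `x` of the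
  -- domain, possibly only a vertex or an edge.
  refine eq_on_preconnected M.connected.isPreconnected interior_subset ?_ (hint E₀) (hint E₁)
  intro E E' x hxd hx hx'
  obtain ⟨ρ, hρ, hball⟩ := Metric.isOpen_iff.1 (isOpen_interior : IsOpen M.domain) x hxd
  have hmeet : ∀ K : M.Cell, x ∈ K.carrier → (interior K.carrier ∩ Metric.ball x ρ).Nonempty := by
    intro K hK
    have h1 : x ∈ closure (interior K.carrier) := by
      rw [K.convex_carrier.closure_interior_eq_closure_of_nonempty_interior K.exists_mem_interior]
      exact subset_closure hK
    rw [Set.inter_comm]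
    exact mem_closure_iff.1 h1 _ Metric.isOpen_ball (Metric.mem_ball_self hρ)
  obtain ⟨y₁, hy₁, hy₁b⟩ := hmeet E hx
  -- A generic choice: the spans of `y₁` with intersections of fewer than `d` vertices are finitely
  -- many proper affine subspaces, hence null. The segment from `y₁` to `y₂` then passes from
  -- element to element only through facets.
  obtain ⟨y₂, ⟨hy₂, hy₂b⟩, hgen⟩ : ∃ y₂ ∈ interior E'.carrier ∩ Metric.ball x ρ,
      ∀ K K' : M.Cell, (K.verts ∩ K'.verts).card < d →
        y₂ ∉ affineSpan ℝ ((insert y₁ (K.verts ∩ K'.verts) : Finset (Pt d)) : Set (Pt d)) := by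
    have hnull : volume (⋃ (K : M.Cell) (K' : M.Cell) (_ : (K.verts ∩ K'.verts).card < d),
        (affineSpan ℝ ((insert y₁ (K.verts ∩ K'.verts) : Finset (Pt d)) : Set (Pt d)) :
          Set (Pt d))) = 0 := by
      refine measure_iUnion_null fun K => measure_iUnion_null fun K' =>
        measure_iUnion_null fun hlt => Measure.addHaar_affineSubspace _ _ ?_
      exact affineSpan_ne_top_of_card_le ((Finset.card_insert_le _ _).trans hlt)
    by_contra! h
    have hsub : interior E'.carrier ∩ Metric.ball x ρ ⊆
        ⋃ (K : M.Cell) (K' : M.Cell) (_ : (K.verts ∩ K'.verts).card < d),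
        (affineSpan ℝ ((insert y₁ (K.verts ∩ K'.verts) : Finset (Pt d)) : Set (Pt d)) :
          Set (Pt d)) := fun y hy => by
      obtain ⟨K, K', hlt, hm⟩ := h y hy
      exact Set.mem_iUnion₂.2 ⟨K, K', Set.mem_iUnion.2 ⟨hlt, hm⟩⟩
    exact ((isOpen_interior.inter Metric.isOpen_ball).measure_pos volume (hmeet E' hx')).ne'
      (measure_mono_null hsub hnull)
  have hseg : segment ℝ y₁ y₂ ⊆ M.complex.space :=
    ((convex_ball x ρ).segment_subset hy₁b hy₂b).trans (hball.trans interior_subset)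
  refine eq_on_preconnected (convex_segment y₁ y₂).isPreconnected hseg ?_
    ⟨y₁, left_mem_segment ℝ _ _, interior_subset hy₁⟩
    ⟨y₂, right_mem_segment ℝ _ _, interior_subset hy₂⟩
  intro K K' z hz hzK hzK'
  by_cases hKK : K = K'
  · rw [hKK]
  have hzi : z ∈ convexHull ℝ ((K.verts ∩ K'.verts : Finset (Pt d)) : Set (Pt d)) := by
    rw [Finset.coe_inter]
    exact M.complex.inter_subset_convexHull K.2.1 K'.2.1 ⟨hzK, hzK'⟩
  rcases (Cell.card_inter_le hKK).lt_or_eq with hlt | heq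
  · exfalso
    rw [segment_eq_image_lineMap] at hz
    obtain ⟨t, ht, rfl⟩ := hz
    -- At the endpoint `y₁`, interior to `E`, only one element is present. At any other parameter,
    -- `y₂` lies on the line through `y₁` and the point `z` of the low-dimensional intersection,
    -- against genericity.
    by_cases ht0 : t = 0
    · subst ht0
      rw [AffineMap.lineMap_apply_zero] at hzK hzK'
      have h1 : ∀ L : M.Cell, y₁ ∈ L.carrier → E = L := fun L hL =>
        Cell.ext_of_subset fun r hr => Cell.mem_verts_of_bary_pos hL (interior_subset hy₁)
          (Cell.mem_interior_iff.1 hy₁ r hr)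
      exact hKK ((h1 K hzK).symm.trans (h1 K' hzK'))
    · refine hgen K K' hlt ?_
      have hz' := convexHull_subset_affineSpan (𝕜 := ℝ) _ hzi
      have hz'' := affineSpan_mono ℝ (Finset.coe_subset.2 (Finset.subset_insert y₁ _)) hz'
      have hy1 : y₁ ∈ affineSpan ℝ ((insert y₁ (K.verts ∩ K'.verts) : Finset (Pt d)) :
          Set (Pt d)) := subset_affineSpan ℝ _ (Finset.mem_coe.2 (Finset.mem_insert_self _ _))
      have := AffineMap.lineMap_mem (k := ℝ) t⁻¹ hy1 hz''
      rwa [AffineMap.lineMap_lineMap_right, inv_mul_cancel₀ ht0, AffineMap.lineMap_apply_one]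
        at this
  · obtain ⟨a, ha, a', ha', he⟩ := Cell.exists_erase_eq heq
    exact hf K K' a a' ha ha' he hKK

end MSMFE.Mesh

namespace MSMFE

/-! ### Integration over the reference simplex -/

/-- The reference simplex, with one coordinate singled out. -/
def refSimplex (ι : Type*) [Fintype ι] : Set (ℝ × (ι → ℝ)) :=
  {z | 0 ≤ z.1 ∧ (∀ i, 0 ≤ z.2 i) ∧ z.1 + ∑ i, z.2 i ≤ 1}

/-- The facet of the reference simplex on which the distinguished coordinate vanishes. -/
def refFacet (ι : Type*) [Fintype ι] : Set (ι → ℝ) :=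
  {y | (∀ i, 0 ≤ y i) ∧ ∑ i, y i ≤ 1}

section reference

variable {ι : Type*} [Fintype ι]

lemma isClosed_nonneg {ι : Type*} : IsClosed {y : ι → ℝ | ∀ i, 0 ≤ y i} := by
  have : {y : ι → ℝ | ∀ i, 0 ≤ y i} = ⋂ i, {y | 0 ≤ y i} := by ext; simp
  rw [this]
  exact isClosed_iInter fun i => isClosed_le continuous_const (continuous_apply i)

lemma isClosed_refFacet : IsClosed (refFacet ι) :=
  isClosed_nonneg.inter (isClosed_le (by fun_prop : Continuous fun y : ι → ℝ => ∑ i, y i)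
    continuous_const)

lemma isCompact_refSimplex : IsCompact (refSimplex ι) := by
  refine (isCompact_Icc (a := (0 : ℝ × (ι → ℝ))) (b := 1)).of_isClosed_subset ?_ ?_
  · exact (isClosed_le continuous_const continuous_fst).inter
      ((isClosed_nonneg.preimage continuous_snd).inter
        (isClosed_le (by fun_prop : Continuous fun z : ℝ × (ι → ℝ) => z.1 + ∑ i, z.2 i)
          continuous_const))
  · rintro ⟨x, y⟩ ⟨hx, hy, hs⟩
    simp only at hx hy hs
    have hsum : 0 ≤ ∑ i, y i := Finset.sum_nonneg fun i _ => hy i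
    refine ⟨⟨hx, hy⟩, ?_, fun i => ?_⟩
    · simp; linarith
    · have := Finset.single_le_sum (fun j _ => hy j) (Finset.mem_univ i)
      simp; linarith

/-- Fubini with the distinguished coordinate innermost, then the fundamental theorem of calculus on
each line. -/
lemma integral_refSimplex_deriv {ψ ψ' : ℝ × (ι → ℝ) → ℝ} (hc : Continuous ψ')
    (hd : ∀ x y, HasDerivAt (fun t => ψ (t, y)) (ψ' (x, y)) x) :
    ∫ z in refSimplex ι, ψ' z =
      ∫ y in refFacet ι, (ψ (1 - ∑ i, y i, y) - ψ (0, y)) := by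
  have hm : MeasurableSet (refSimplex ι) := isCompact_refSimplex.isClosed.measurableSet
  have hmF : MeasurableSet (refFacet ι) := isClosed_refFacet.measurableSet
  have hint : Integrable ((refSimplex ι).indicator ψ') (volume.prod volume) :=
    (hc.continuousOn.integrableOn_compact isCompact_refSimplex).integrable_indicator hm
  rw [← integral_indicator hm, Measure.volume_eq_prod, integral_prod_symm _ hint,
    ← integral_indicator hmF]
  refine integral_congr_ae (Filter.Eventually.of_forall fun y => ?_)
  by_cases hy : y ∈ refFacet ι
  · have h1 : ∀ x : ℝ, (refSimplex ι).indicator ψ' (x, y) =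
        (Set.Icc 0 (1 - ∑ i, y i)).indicator (fun x => ψ' (x, y)) x := by
      intro x
      have : (x, y) ∈ refSimplex ι ↔ x ∈ Set.Icc 0 (1 - ∑ i, y i) := by
        simp only [refSimplex, Set.mem_ofPred_eq, Set.mem_Icc, hy.1, implies_true, true_and]
        exact and_congr_right fun _ => by rw [le_sub_iff_add_le]
      by_cases h : (x, y) ∈ refSimplex ι
      · rw [Set.indicator_of_mem h, Set.indicator_of_mem (this.1 h)]
      · rw [Set.indicator_of_notMem h, Set.indicator_of_notMem (fun h' => h (this.2 h'))]
    simp only [h1, Set.indicator_of_mem hy]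
    rw [integral_indicator measurableSet_Icc, integral_Icc_eq_integral_Ioc,
      ← intervalIntegral.integral_of_le (by linarith [hy.2])]
    exact intervalIntegral.integral_eq_sub_of_hasDerivAt (fun x _ => hd x y)
      (by exact (Continuous.intervalIntegrable (by fun_prop) _ _))
  · have h1 : ∀ x : ℝ, (refSimplex ι).indicator ψ' (x, y) = 0 := by
      intro x
      refine Set.indicator_of_notMem (fun h => hy ⟨h.2.1, ?_⟩) _
      linarith [h.1, h.2.2]
    simp [h1, hy]

end reference

namespace Mesh

open scoped Classical

variable {d : ℕ} {M : Mesh d}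

/-! ### Integration by parts on an element -/

lemma Cell.bary_linear_vertex {E : M.Cell} {r s x : Pt d} (hr : r ∈ E.verts) (hs : s ∈ E.verts) :
    (E.bary x).linear (s - r) = (if x = s then 1 else 0) - (if x = r then 1 else 0) := by
  have h : ∀ y ∈ E.verts, E.bary x y = if x = y then 1 else 0 := fun y hy => by
    split_ifs with h
    · rw [h, Cell.bary_self hy]
    · exact Cell.bary_ne hy h
  rw [Cell.bary_linear_sub, h s hs, h r hr]

/-- Linear coordinates on `ℝ^d` adapted to a pair of vertices `a`, `r` of the element `E`. -/
noncomputable def Cell.chart (E : M.Cell) {a r : Pt d} (ha : a ∈ E.verts)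
    (hr : r ∈ E.verts.erase a) :
    (ℝ × (((E.verts.erase a).erase r : Finset (Pt d)) → ℝ)) ≃ₗ[ℝ] Pt d where
  toFun z := z.1 • (a - r) + ∑ s, z.2 s • ((s : Pt d) - r)
  map_add' z w := by
    simp only [Prod.fst_add, Prod.snd_add, Pi.add_apply, add_smul, Finset.sum_add_distrib]
    abel
  map_smul' c z := by
    simp only [Prod.smul_fst, Prod.smul_snd, Pi.smul_apply, smul_eq_mul, mul_smul, smul_add,
      Finset.smul_sum, RingHom.id_apply]
  invFun v := ((E.bary a).linear v, fun s => (E.bary s).linear v)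
  left_inv z := by
    have hr' := Finset.mem_of_mem_erase hr
    have hra := Finset.ne_of_mem_erase hr
    refine Prod.ext ?_ (funext fun s => ?_)
    · simp only [map_add, map_smul, map_sum, smul_eq_mul]
      rw [Cell.bary_linear_vertex hr' ha, if_pos rfl, if_neg hra.symm, Finset.sum_eq_zero]
      · ring
      · intro s _
        have hs := Finset.mem_of_mem_erase s.2
        rw [Cell.bary_linear_vertex hr' (Finset.mem_of_mem_erase hs),
          if_neg (Finset.ne_of_mem_erase hs).symm, if_neg hra.symm]
        ring
    · have hs := Finset.mem_of_mem_erase s.2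
      have hsr := Finset.ne_of_mem_erase s.2
      simp only [map_add, map_smul, map_sum, smul_eq_mul]
      rw [Cell.bary_linear_vertex hr' ha, if_neg (Finset.ne_of_mem_erase hs), if_neg hsr,
        Finset.sum_eq_single s]
      · rw [Cell.bary_linear_vertex hr' (Finset.mem_of_mem_erase hs), if_pos rfl, if_neg hsr]
        ring
      · intro t _ hts
        rw [Cell.bary_linear_vertex hr' (Finset.mem_of_mem_erase (Finset.mem_of_mem_erase t.2)),
          if_neg (fun h => hts (Subtype.ext h.symm)), if_neg hsr]
        ring
      · simp
  right_inv v := by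
    have hr' := Finset.mem_of_mem_erase hr
    have h1 : v = ∑ s ∈ E.verts, (E.bary s).linear v • (s - r) := by
      have h2 : ∀ s, (E.bary s).linear v = E.bary s (r + v) - E.bary s r := fun s => by
        rw [Cell.bary_add]; ring
      simp only [h2, sub_smul, smul_sub, Finset.sum_sub_distrib, ← Finset.sum_smul]
      rw [E.sum_bary_smul, E.sum_bary_smul, E.sum_bary, E.sum_bary]
      abel
    conv_rhs => rw [h1]
    rw [← Finset.add_sum_erase _ _ ha, ← Finset.add_sum_erase _ _ hr, sub_self, smul_zero,
      zero_add]
    exact congrArg _ <| Finset.sum_coe_sort ((E.verts.erase a).erase r)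
      fun s => (E.bary s).linear v • (s - r)

lemma Cell.chart_apply (E : M.Cell) {a r : Pt d} (ha : a ∈ E.verts) (hr : r ∈ E.verts.erase a)
    (z : ℝ × (((E.verts.erase a).erase r : Finset (Pt d)) → ℝ)) :
    E.chart ha hr z = z.1 • (a - r) + ∑ s, z.2 s • ((s : Pt d) - r) := rfl

lemma Cell.bary_chart (E : M.Cell) {a r : Pt d} (ha : a ∈ E.verts) (hr : r ∈ E.verts.erase a)
    (z : ℝ × (((E.verts.erase a).erase r : Finset (Pt d)) → ℝ)) :
    E.bary a (r + E.chart ha hr z) = z.1 ∧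
    (∀ s : ((E.verts.erase a).erase r : Finset (Pt d)), E.bary s (r + E.chart ha hr z) = z.2 s) ∧
    E.bary r (r + E.chart ha hr z) = 1 - z.1 - ∑ s, z.2 s := by
  have hr' := Finset.mem_of_mem_erase hr
  have h := (E.chart ha hr).left_inv z
  have h1 : E.bary a (r + E.chart ha hr z) = z.1 := by
    rw [Cell.bary_add, Cell.bary_ne hr' (Finset.ne_of_mem_erase hr).symm, zero_add]
    exact congrArg Prod.fst h
  have h2 : ∀ s : ((E.verts.erase a).erase r : Finset (Pt d)),
      E.bary s (r + E.chart ha hr z) = z.2 s := fun s => by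
    rw [Cell.bary_add, Cell.bary_ne hr' (Finset.ne_of_mem_erase s.2), zero_add]
    exact congrFun (congrArg Prod.snd h) s
  refine ⟨h1, h2, ?_⟩
  have h3 := E.sum_bary (r + E.chart ha hr z)
  rw [← Finset.add_sum_erase _ _ ha, ← Finset.add_sum_erase _ _ hr, h1,
    ← Finset.sum_coe_sort ((E.verts.erase a).erase r)] at h3
  simp only [h2] at h3
  linarith

lemma Cell.chart_mem_carrier_iff (E : M.Cell) {a r : Pt d} (ha : a ∈ E.verts)
    (hr : r ∈ E.verts.erase a)
    (z : ℝ × (((E.verts.erase a).erase r : Finset (Pt d)) → ℝ)) :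
    r + E.chart ha hr z ∈ E.carrier ↔ z ∈ refSimplex _ := by
  obtain ⟨h1, h2, h3⟩ := E.bary_chart ha hr z
  rw [Cell.mem_carrier_iff]
  constructor
  · intro h
    refine ⟨h1 ▸ h a ha, fun s => h2 s ▸ h s (Finset.mem_of_mem_erase
      (Finset.mem_of_mem_erase s.2)), ?_⟩
    have := h r (Finset.mem_of_mem_erase hr)
    rw [h3] at this
    linarith
  · rintro ⟨k1, k2, k3⟩ x hx
    by_cases hxa : x = a
    · rw [hxa, h1]; exact k1
    · by_cases hxr : x = r
      · rw [hxr, h3]; linarith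
      · have := h2 ⟨x, Finset.mem_erase.2 ⟨hxr, Finset.mem_erase.2 ⟨hxa, hx⟩⟩⟩
        simp only at this
        rw [this]; exact k2 _

/-- The mean value over an element as a mean value over the reference simplex. -/
lemma Cell.average_eq (E : M.Cell) {a r : Pt d} (ha : a ∈ E.verts) (hr : r ∈ E.verts.erase a)
    (f : Pt d → ℝ) :
    E.vol⁻¹ * ∫ x in E.carrier, f x =
      (volume.real (refSimplex ((E.verts.erase a).erase r : Finset (Pt d))))⁻¹ *
        ∫ z in refSimplex ((E.verts.erase a).erase r : Finset (Pt d)),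
          f (r + E.chart ha hr z) := by
  set L := (E.chart ha hr).toContinuousLinearEquiv with hL
  have hLz : ∀ z, L z = E.chart ha hr z := fun z => rfl
  let Φ := L.toHomeomorph.trans (Homeomorph.addLeft r)
  have hΦ : ∀ z, Φ z = r + E.chart ha hr z := fun z => rfl
  have : (volume : Measure (ℝ × (((E.verts.erase a).erase r : Finset (Pt d)) → ℝ))).IsAddHaarMeasure :=
    Measure.prod.instIsAddHaarMeasure _ _
  have : Measure.IsAddHaarMeasure (Measure.map L (volume : Measure (ℝ × _))) :=
    L.isAddHaarMeasure_map _
  -- Uniqueness of Haar measure supplies the constant Jacobian; it cancels in the mean values and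
  -- never has to be computed.
  obtain ⟨c, hc⟩ : ∃ c : NNReal, (volume : Measure (Pt d)) = c • Measure.map L volume :=
    ⟨_, Measure.isAddLeftInvariant_eq_smul _ _⟩
  have hmap : (volume : Measure (Pt d)) = c • Measure.map Φ volume := by
    have : Measure.map Φ (volume : Measure (ℝ × _)) = Measure.map L volume := by
      have h1 : Measure.map (fun x => r + x) (Measure.map L (volume : Measure (ℝ × _))) =
          Measure.map L volume := map_add_left_eq_self _ r
      rw [← h1, Measure.map_map (measurable_const_add r) L.continuous.measurable]
      rfl
    rw [this]; exact hc
  have hpre : Φ ⁻¹' E.carrier = refSimplex _ := by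
    ext z
    rw [Set.mem_preimage, hΦ, Cell.chart_mem_carrier_iff]
  have key : ∀ g : Pt d → ℝ, ∫ x in E.carrier, g x =
      c * ∫ z in refSimplex _, g (r + E.chart ha hr z) := by
    intro g
    have : (volume.restrict E.carrier : Measure (Pt d)) =
        c • (Measure.map Φ volume).restrict E.carrier := by
      conv_lhs => rw [hmap]
      rw [Measure.restrict_smul]
    rw [this, integral_smul_nnreal_measure, ← Homeomorph.toMeasurableEquiv_coe,
      setIntegral_map_equiv]
    simp only [Homeomorph.toMeasurableEquiv_coe, hpre, hΦ]
    rfl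
  have hvol : E.vol = c * volume.real (refSimplex ((E.verts.erase a).erase r :
      Finset (Pt d))) := by
    have := key fun _ => 1
    simpa [Cell.vol] using this
  have hc0 : (c : ℝ) ≠ 0 := by
    intro h0
    rw [h0, zero_mul] at hvol
    exact E.vol_pos.ne' hvol
  rw [key, hvol, mul_inv]
  field_simp

/-- The weighted mean value of `φ` over the facet with vertices `F`, the weight being (a multiple of) the
barycentric coordinate of the vertex `r`. -/
noncomputable def facetMean (F : Finset (Pt d)) (r : Pt d) (φ : Pt d → ℝ) : ℝ :=
  (volume.real (refSimplex (F.erase r : Finset (Pt d))))⁻¹ *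
    ∫ y in refFacet (F.erase r : Finset (Pt d)),
      (1 - ∑ s, y s) * φ (r + ∑ s, y s • ((s : Pt d) - r))

lemma facetMean_eq_zero {F : Finset (Pt d)} {r : Pt d} (hr : r ∈ F) {φ : Pt d → ℝ}
    (hφ : ∀ x ∈ convexHull ℝ (F : Set (Pt d)), φ x = 0) : facetMean F r φ = 0 := by
  rw [facetMean, setIntegral_congr_fun (g := fun _ => (0 : ℝ)), integral_zero, mul_zero]
  · exact isClosed_refFacet.measurableSet
  · intro y hy
    beta_reduce
    rw [hφ, mul_zero]
    have h1 : r + ∑ s, y s • ((s : Pt d) - r) =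
        ∑ o : Option (F.erase r : Finset (Pt d)),
          (o.elim (1 - ∑ s, y s) y) • (o.elim r fun s => (s : Pt d)) := by
      simp only [Fintype.sum_option, Option.elim, smul_sub, Finset.sum_sub_distrib,
        ← Finset.sum_smul, sub_smul, one_smul]
      abel
    rw [h1]
    refine (convex_convexHull ℝ _).sum_mem (fun o _ => ?_) ?_ fun o _ => ?_
    · cases o with
      | none => simpa using hy.2
      | some s => exact hy.1 s
    · simp [Fintype.sum_option]
    · refine subset_convexHull ℝ _ ?_
      cases o with
      | none => exact hr
      | some s => exact Finset.mem_of_mem_erase s.2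

/-- Integration by parts in the direction of an edge. -/
lemma Cell.integral_by_parts (E : M.Cell) {a r : Pt d} (ha : a ∈ E.verts)
    (hr : r ∈ E.verts.erase a) {φ : Pt d → ℝ} (hφ : ContDiff ℝ ∞ φ) :
    E.vol⁻¹ * ∫ x in E.carrier, (E.bary r x * fderiv ℝ φ x (a - r) - φ x) =
      - facetMean (E.verts.erase a) r φ := by
  rw [E.average_eq ha hr, facetMean, ← mul_neg]
  congr 1
  set c : ℝ × (((E.verts.erase a).erase r : Finset (Pt d)) → ℝ) → Pt d :=
    fun z => r + E.chart ha hr z with hc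
  have hcc : Continuous c := by
    have : Continuous (E.chart ha hr) := LinearMap.continuous_of_finiteDimensional
      (E.chart ha hr).toLinearMap
    exact continuous_const.add this
  have hbc : ∀ z, E.bary r (c z) = 1 - z.1 - ∑ s, z.2 s := fun z => (E.bary_chart ha hr z).2.2
  have hdφ : Continuous fun x => fderiv ℝ φ x (a - r) :=
    (hφ.continuous_fderiv (by simp)).clm_apply continuous_const
  have hφc := hφ.continuous
  -- In direction `a - r` the coordinate of `r` decreases at unit rate, so the integrand is the
  -- derivative of λ_r φ. At the upper limit λ_r = 0, so only the facet opposite `a` contributes.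
  rw [integral_refSimplex_deriv (ψ := fun z => E.bary r (c z) * φ (c z))
    (ψ' := fun z => E.bary r (c z) * fderiv ℝ φ (c z) (a - r) - φ (c z)), ← integral_neg]
  · congr 1
    funext y
    simp only [hbc]
    simp [hc, Cell.chart_apply]
  · simp only [hbc]
    have h1 : Continuous fun z => fderiv ℝ φ (c z) (a - r) := hdφ.comp hcc
    have h2 : Continuous fun z => φ (c z) := hφc.comp hcc
    fun_prop
  · intro x y
    have hcd : HasDerivAt (fun t : ℝ => c (t, y)) (a - r) x := by
      have : (fun t : ℝ => c (t, y)) = fun t : ℝ =>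
          t • (a - r) + (r + ∑ s, y s • ((s : Pt d) - r)) := by
        funext t
        simp only [hc, Cell.chart_apply]
        abel
      rw [this]
      simpa using ((hasDerivAt_id x).smul_const (a - r)).add_const
        (r + ∑ s, y s • ((s : Pt d) - r))
    have h1 : HasDerivAt (fun t : ℝ => φ (c (t, y))) (fderiv ℝ φ (c (x, y)) (a - r)) x :=
      ((hφ.differentiable (by simp)) _).hasFDerivAt.comp_hasDerivAt x hcd
    have h2 : HasDerivAt (fun t : ℝ => E.bary r (c (t, y))) (-1) x := by
      simp only [hbc]
      simpa using ((hasDerivAt_id x).const_sub 1).sub_const (∑ s, y s)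
    convert! h2.mul h1 using 1
    ring

end Mesh
end MSMFE

namespace MSMFE.Mesh

open scoped Classical

variable {d : ℕ} {M : Mesh d}

/-! ### Test fields in the stress space -/

/-- The contribution `(τ, ∇φ)_E + (div τ, φ)_E` of an element to the weak divergence of row `i`. -/
noncomputable def Cell.residual (E : M.Cell) (f : Pt d →ᵃ[ℝ] Tensor d) (i : Fin d)
    (φ : Pt d → ℝ) : ℝ :=
  ∫ x in E.carrier, ((∑ j, f x i j * fderiv ℝ φ x (e j)) + affineDiv f i * φ x)

lemma continuous_affine_apply (f : Pt d →ᵃ[ℝ] Tensor d) (i j : Fin d) :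
    Continuous fun x => f x i j :=
  ((Matrix.entryLinearMap ℝ ℝ i j).toAffineMap.comp f).continuous_of_finiteDimensional

lemma Cell.memLp_indicator (E : M.Cell) {f : Pt d → ℝ} (hf : Continuous f) (S : Set (Pt d)) :
    MemLp ((interior E.carrier).indicator f) 2 (volume.restrict S) := by
  refine MemLp.restrict S ?_
  rw [memLp_indicator_iff_restrict isOpen_interior.measurableSet]
  obtain ⟨C, hC⟩ := E.isCompact_carrier.exists_bound_of_continuousOn hf.continuousOn
  have : IsFiniteMeasure (volume.restrict (interior E.carrier)) :=
    ⟨by rw [Measure.restrict_apply_univ]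
        exact (measure_mono interior_subset).trans_lt E.isCompact_carrier.measure_lt_top⟩
  refine MemLp.of_bound hf.aestronglyMeasurable C ?_
  filter_upwards [ae_restrict_mem isOpen_interior.measurableSet] with x hx
  exact hC x (interior_subset hx)

lemma field_apply (τ : M.BrokenP1) (x : Pt d) (i j : Fin d) :
    M.field τ x i j =
      ∑ E : M.Cell, (interior E.carrier).indicator (fun y => τ E y i j) x := by
  rw [field, Matrix.sum_apply]
  refine Finset.sum_congr rfl fun E _ => ?_
  by_cases h : x ∈ interior E.carrier <;> simp [h]

lemma memL2_field (τ : M.BrokenP1) (S : Set (Pt d)) : MemL2Tensor S (M.field τ) := by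
  intro i j
  simp only [field_apply]
  exact memLp_finsetSum _ fun E _ => E.memLp_indicator (continuous_affine_apply (τ E) i j) S

/-- The element-wise divergence. -/
noncomputable def fieldDiv (τ : M.BrokenP1) (x : Pt d) (i : Fin d) : ℝ :=
  ∑ E : M.Cell, (interior E.carrier).indicator (fun _ => affineDiv (τ E) i) x

lemma memL2_fieldDiv (τ : M.BrokenP1) (S : Set (Pt d)) : MemL2Vector S (fieldDiv τ) := fun _ =>
  memLp_finsetSum _ fun E _ => E.memLp_indicator continuous_const S

/-- The boundaries of convex elements are null sets, so integrals over the interiors and over the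
closed elements agree. -/
lemma integral_add_eq_sum_residual (τ : M.BrokenP1) (i : Fin d) {φ : Pt d → ℝ}
    (hφ : ContDiff ℝ ∞ φ) (hc : HasCompactSupport φ) :
    (∫ x in M.domain, ∑ j, M.field τ x i j * fderiv ℝ φ x (e j)) +
      ∫ x in M.domain, fieldDiv τ x i * φ x = ∑ E : M.Cell, E.residual (τ E) i φ := by
  rw [← integral_add (integrable_grad (memL2_field τ _) i hφ hc)
    (integrable_val (memL2_fieldDiv τ _) i hφ hc)]
  have hpt : ∀ x, (∑ j, M.field τ x i j * fderiv ℝ φ x (e j)) + fieldDiv τ x i * φ x =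
      ∑ E : M.Cell, (interior E.carrier).indicator
        (fun x => (∑ j, τ E x i j * fderiv ℝ φ x (e j)) + affineDiv (τ E) i * φ x) x := by
    intro x
    simp only [field_apply, fieldDiv, Finset.sum_mul]
    rw [Finset.sum_comm, ← Finset.sum_add_distrib]
    refine Finset.sum_congr rfl fun E _ => ?_
    by_cases h : x ∈ interior E.carrier <;> simp [h]
  simp only [hpt]
  have hcont : ∀ E : M.Cell, Continuous
      fun x => (∑ j, τ E x i j * fderiv ℝ φ x (e j)) + affineDiv (τ E) i * φ x := by
    intro E
    refine (continuous_finsetSum _ fun j _ => (continuous_affine_apply (τ E) i j).mul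
      ((hφ.continuous_fderiv (by simp)).clm_apply continuous_const)).add
      (continuous_const.mul hφ.continuous)
  rw [integral_finsetSum]
  · refine Finset.sum_congr rfl fun E _ => ?_
    rw [setIntegral_indicator isOpen_interior.measurableSet,
      Set.inter_eq_self_of_subset_right E.interior_subset_domain, Cell.residual]
    exact setIntegral_congr_set
      (interior_ae_eq_of_null_frontier (E.convex_carrier.addHaar_frontier volume))
  · intro E _
    refine Integrable.restrict ?_
    rw [integrable_indicator_iff isOpen_interior.measurableSet]
    exact ((hcont E).continuousOn.integrableOn_compact E.isCompact_carrier).mono_set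
      interior_subset

lemma eq_zero_on_dirichlet {φ : Pt d → ℝ} (h : tsupport φ ⊆ M.domain) :
    ∀ x ∈ M.dirichlet, φ x = 0 := by
  intro x hx
  obtain ⟨F, hF, hxF⟩ := Set.mem_iUnion₂.1 hx
  have hfr : x ∈ frontier M.domain := hF.1.2 hxF
  rw [IsOpen.frontier_eq (s := M.domain) isOpen_interior] at hfr
  exact image_eq_zero_of_notMem_tsupport fun hx' => hfr.2 (h hx')

/-- Test functions supported in the open domain vanish on the Dirichlet boundary, so one condition
yields both the weak divergence and the vanishing normal trace. -/
lemma mem_stressSpace_of_residual {τ : M.BrokenP1}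
    (h : ∀ (i : Fin d) (φ : Pt d → ℝ), ContDiff ℝ ∞ φ → (∀ x ∈ M.dirichlet, φ x = 0) →
      ∑ E : M.Cell, E.residual (τ E) i φ = 0) : τ ∈ M.stressSpace := by
  refine ⟨memL2_field τ _, fieldDiv τ, memL2_fieldDiv τ _, ?_, ?_⟩
  · intro i φ hφ hc hs
    rw [← add_eq_zero_iff_eq_neg, integral_add_eq_sum_residual τ i hφ hc]
    exact h i φ hφ (eq_zero_on_dirichlet hs)
  · intro i φ hφ hc hD
    rw [integral_add_eq_sum_residual τ i hφ hc]
    exact h i φ hφ hD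

/-- The affine field `|E|⁻¹ λ_r t ⊗ (a - r)` on the element `E`. -/
noncomputable def Cell.piece (E : M.Cell) (a r : Pt d) (t : Fin d → ℝ) : Pt d →ᵃ[ℝ] Tensor d :=
  ((LinearMap.toSpanSingleton ℝ (Tensor d)
    (E.vol⁻¹ • Matrix.vecMulVec t (a - r).ofLp)).toAffineMap).comp (E.bary r)

lemma Cell.piece_apply (E : M.Cell) (a r : Pt d) (t : Fin d → ℝ) (x : Pt d) :
    E.piece a r t x = E.bary r x • (E.vol⁻¹ • Matrix.vecMulVec t (a - r).ofLp) := rfl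

lemma Cell.piece_linear (E : M.Cell) (a r : Pt d) (t : Fin d → ℝ) (x : Pt d) :
    (E.piece a r t).linear x =
      (E.bary r).linear x • (E.vol⁻¹ • Matrix.vecMulVec t (a - r).ofLp) := rfl

lemma sum_mul_apply_e (L : Pt d →ₗ[ℝ] ℝ) (w : Pt d) : ∑ j, w j * L (e j) = L w := by
  have h : w = ∑ j, w j • e j := by
    ext k
    simp [WithLp.ofLp_sum, Finset.sum_apply, Pi.single_apply]
  conv_rhs => rw [h]
  simp only [map_sum, map_smul, smul_eq_mul]

/-- The coordinate λ_r drops from 1 to 0 along the edge from `r` to `a`, so its derivative in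
direction `a - r` is -1. -/
lemma Cell.affineDiv_piece (E : M.Cell) {a r : Pt d} (ha : a ∈ E.verts)
    (hr : r ∈ E.verts.erase a) (t : Fin d → ℝ) (i : Fin d) :
    affineDiv (E.piece a r t) i = - (E.vol⁻¹ * t i) := by
  have h := sum_mul_apply_e (E.bary r).linear (a - r)
  rw [Cell.bary_linear_vertex (Finset.mem_of_mem_erase hr) ha,
    if_neg (Finset.ne_of_mem_erase hr), if_pos rfl] at h
  have h2 : affineDiv (E.piece a r t) i =
      E.vol⁻¹ * t i * ∑ j, (a - r) j * (E.bary r).linear (e j) := by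
    simp only [affineDiv, Cell.piece_linear, Matrix.smul_apply, Matrix.vecMulVec_apply, smul_eq_mul,
      Finset.mul_sum]
    exact Finset.sum_congr rfl fun j _ => by ring
  rw [h2, h]; ring

/-- The scaling by |E|⁻¹ makes the result depend on the facet, `r`, `t` and `φ` only. This is why
the contributions of two neighbours cancel. -/
lemma Cell.residual_piece (E : M.Cell) {a r : Pt d} (ha : a ∈ E.verts)
    (hr : r ∈ E.verts.erase a) (t : Fin d → ℝ) (i : Fin d) {φ : Pt d → ℝ}
    (hφ : ContDiff ℝ ∞ φ) :
    E.residual (E.piece a r t) i φ = - (t i * facetMean (E.verts.erase a) r φ) := by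
  have hpt : ∀ x, (∑ j, E.piece a r t x i j * fderiv ℝ φ x (e j)) +
      affineDiv (E.piece a r t) i * φ x =
      (t i * E.vol⁻¹) * (E.bary r x * fderiv ℝ φ x (a - r) - φ x) := by
    intro x
    have h := sum_mul_apply_e (fderiv ℝ φ x).toLinearMap (a - r)
    simp only [ContinuousLinearMap.coe_coe] at h
    rw [E.affineDiv_piece ha hr, ← h, mul_sub, Finset.mul_sum, Finset.mul_sum]
    simp only [Cell.piece_apply, Matrix.smul_apply, Matrix.vecMulVec_apply, smul_eq_mul]
    rw [sub_eq_add_neg]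
    congr 1
    · exact Finset.sum_congr rfl fun j _ => by ring
    · ring
  rw [Cell.residual]
  simp only [hpt]
  rw [integral_const_mul, mul_assoc, E.integral_by_parts ha hr hφ, mul_neg]

lemma Cell.residual_neg (E : M.Cell) (f : Pt d →ᵃ[ℝ] Tensor d) (i : Fin d) (φ : Pt d → ℝ) :
    E.residual (-f) i φ = - E.residual f i φ := by
  rw [Cell.residual, Cell.residual, ← integral_neg]
  congr 1
  funext x
  simp [affineDiv, Finset.sum_neg_distrib]
  ring

lemma Cell.residual_zero (E : M.Cell) (i : Fin d) (φ : Pt d → ℝ) : E.residual 0 i φ = 0 := by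
  simp [Cell.residual, affineDiv]

/-- A test field supported on one element with a Dirichlet facet. -/
lemma single_mem_stressSpace {E : M.Cell} {a r : Pt d} (ha : a ∈ E.verts)
    (hr : r ∈ E.verts.erase a) (hF : E.verts.erase a ∈ M.boundaryFacets \ M.neumann)
    (t : Fin d → ℝ) : Pi.single E (E.piece a r t) ∈ M.stressSpace := by
  refine mem_stressSpace_of_residual fun i φ hφ hD => ?_
  rw [Finset.sum_eq_single E]
  · rw [Pi.single_eq_same, E.residual_piece ha hr t i hφ, facetMean_eq_zero hr, mul_zero, neg_zero]
    exact fun x hx => hD x (Set.mem_iUnion₂.2 ⟨_, hF, hx⟩)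
  · intro K _ hK
    rw [Pi.single_eq_of_ne hK, Cell.residual_zero]
  · simp

/-- A test field supported on two elements with a common facet. -/
lemma pair_mem_stressSpace {E E' : M.Cell} {a a' r : Pt d} (ha : a ∈ E.verts)
    (ha' : a' ∈ E'.verts) (he : E'.verts.erase a' = E.verts.erase a) (hne : E ≠ E')
    (hr : r ∈ E.verts.erase a) (t : Fin d → ℝ) :
    (Pi.single E (E.piece a r t) + Pi.single E' (-E'.piece a' r t) : M.BrokenP1) ∈
      M.stressSpace := by
  refine mem_stressSpace_of_residual fun i φ hφ _ => ?_
  rw [Finset.sum_eq_add E E' hne]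
  · rw [Pi.add_apply, Pi.add_apply, Pi.single_eq_same, Pi.single_eq_same, Pi.single_eq_of_ne hne,
      Pi.single_eq_of_ne hne.symm, add_zero, zero_add, Cell.residual_neg,
      E.residual_piece ha hr t i hφ, E'.residual_piece ha' (he ▸ hr) t i hφ, he]
    ring
  · rintro K - ⟨h1, h2⟩
    rw [Pi.add_apply, Pi.single_eq_of_ne h1, Pi.single_eq_of_ne h2, add_zero, Cell.residual_zero]
  · simp
  · simp

/-! ### Unique solvability for the displacement and the rotation -/

/-- The contribution of an element to `(div τ, v) + (τ, ξ)_Q`. -/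
noncomputable def Cell.pairing (E : M.Cell) (v : M.DisplacementSpace) (ξ : M.BrokenP1)
    (f : Pt d →ᵃ[ℝ] Tensor d) : ℝ :=
  E.vol * ∑ i, affineDiv f i * v E i + E.vol / (d + 1) * ∑ r ∈ E.verts, ddot (f r) (ξ E r)

lemma divForm_eq (τ : M.BrokenP1) (v : M.DisplacementSpace) :
    M.divForm τ v = ∑ E : M.Cell, E.vol * ∑ i, affineDiv (τ E) i * v E i := by
  refine Finset.sum_congr rfl fun E _ => ?_
  rw [setIntegral_const, smul_eq_mul]
  rfl

lemma divForm_add_rotationForm (τ : M.BrokenP1) (v : M.DisplacementSpace) (ξ : M.BrokenP1) :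
    M.divForm τ v + M.rotationForm τ ξ = ∑ E : M.Cell, E.pairing v ξ (τ E) := by
  rw [divForm_eq, rotationForm, ← Finset.sum_add_distrib]
  rfl

lemma Cell.pairing_neg (E : M.Cell) (v : M.DisplacementSpace) (ξ : M.BrokenP1)
    (f : Pt d →ᵃ[ℝ] Tensor d) : E.pairing v ξ (-f) = - E.pairing v ξ f := by
  simp [Cell.pairing, affineDiv, ddot, Finset.sum_neg_distrib]
  ring

lemma Cell.pairing_zero (E : M.Cell) (v : M.DisplacementSpace) (ξ : M.BrokenP1) :
    E.pairing v ξ 0 = 0 := by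
  simp [Cell.pairing, affineDiv, ddot]

lemma ddot_vecMulVec (t w : Fin d → ℝ) (X : Tensor d) :
    ddot (Matrix.vecMulVec t w) X = t ⬝ᵥ (X *ᵥ w) := by
  simp only [ddot, Matrix.vecMulVec_apply, dotProduct, Matrix.mulVec, Finset.mul_sum]
  exact Finset.sum_congr rfl fun i _ => Finset.sum_congr rfl fun j _ => by ring

lemma ddot_smul_left (c : ℝ) (σ τ : Tensor d) : ddot (c • σ) τ = c * ddot σ τ := by
  simp only [ddot, Matrix.smul_apply, smul_eq_mul, Finset.mul_sum, mul_assoc]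

/-- Only the vertex `r` contributes to the quadrature, since λ_r vanishes at the others, and the
volume factors cancel. -/
lemma Cell.pairing_piece (E : M.Cell) {a r : Pt d} (ha : a ∈ E.verts) (hr : r ∈ E.verts.erase a)
    (v : M.DisplacementSpace) (ξ : M.BrokenP1) (t : Fin d → ℝ) :
    E.pairing v ξ (E.piece a r t) =
      t ⬝ᵥ (((d : ℝ) + 1)⁻¹ • (ξ E r *ᵥ (a - r).ofLp) - v E) := by
  have hv := E.vol_pos.ne'
  have hr' := Finset.mem_of_mem_erase hr
  rw [Cell.pairing, Finset.sum_eq_single r]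
  · rw [Cell.piece_apply, Cell.bary_self hr', one_smul, ddot_smul_left, ddot_vecMulVec,
      dotProduct_sub, dotProduct_smul, smul_eq_mul]
    simp only [E.affineDiv_piece ha hr, dotProduct]
    simp only [neg_mul, mul_assoc, Finset.sum_neg_distrib, ← Finset.mul_sum]
    field_simp
    ring
  · intro s hs hsr
    rw [Cell.piece_apply, Cell.bary_ne hs (Ne.symm hsr), zero_smul]
    simp [ddot]
  · exact fun h => absurd hr' h

lemma Cell.mem_vertices {E : M.Cell} {r : Pt d} (hr : r ∈ E.verts) : r ∈ M.complex.vertices :=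
  M.complex.down_closed E.2.1 (Finset.singleton_subset_iff.2 hr) (Finset.singleton_nonempty _)

/-- The forms `(div τ, v)` and `(τ, ξ)_Q` on the stress space jointly determine `v` and `ξ`. -/
theorem eq_zero_of_divForm_add_rotationForm (hd : d = 2 ∨ d = 3) (hM : M.HasMacroelementPartition)
    {v : M.DisplacementSpace} {ξ : M.BrokenP1} (hξ : ξ ∈ M.rotationSpace)
    (h : ∀ τ ∈ M.stressSpace, M.divForm τ v + M.rotationForm τ ξ = 0) : v = 0 ∧ ξ = 0 := by
  obtain ⟨hskew, X, -, hX⟩ := hξ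
  have hXv : ∀ (E : M.Cell), ∀ r ∈ E.verts, ξ E r = X r := fun E r hr =>
    (hX E r (E.verts_subset_carrier hr)).symm
  have hXs : ∀ r ∈ M.complex.vertices, (X r)ᵀ = -X r := fun r hr => by
    obtain ⟨E, hE⟩ := exists_cell_of_face hr
    have hrE := hE (Finset.mem_singleton_self r)
    rw [← hXv E r hrE]
    exact hskew E r (E.verts_subset_carrier hrE)
  have hpair : ∀ (E E' : M.Cell) (a a' : Pt d), a ∈ E.verts → a' ∈ E'.verts →
      E'.verts.erase a' = E.verts.erase a → E ≠ E' → ∀ r ∈ E.verts.erase a,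
      v E' - v E = ((d : ℝ) + 1)⁻¹ • (X r *ᵥ (a' - a).ofLp) := by
    intro E E' a a' ha ha' he hne r hr
    have hr' : r ∈ E'.verts.erase a' := he ▸ hr
    have key : ((d : ℝ) + 1)⁻¹ • (X r *ᵥ (a - r).ofLp) - v E -
        (((d : ℝ) + 1)⁻¹ • (X r *ᵥ (a' - r).ofLp) - v E') = 0 := by
      refine dotProduct_eq_zero _ fun t => ?_
      have h1 := h _ (pair_mem_stressSpace ha ha' he hne hr t)
      rw [divForm_add_rotationForm, Finset.sum_eq_add E E' hne] at h1
      · rw [Pi.add_apply, Pi.add_apply, Pi.single_eq_same, Pi.single_eq_same,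
          Pi.single_eq_of_ne hne, Pi.single_eq_of_ne hne.symm, add_zero, zero_add,
          Cell.pairing_neg, E.pairing_piece ha hr, E'.pairing_piece ha' hr',
          hXv E r (Finset.mem_of_mem_erase hr), hXv E' r (Finset.mem_of_mem_erase hr')] at h1
        rw [dotProduct_comm, dotProduct_sub]
        linarith
      · rintro K - ⟨h1, h2⟩
        rw [Pi.add_apply, Pi.single_eq_of_ne h1, Pi.single_eq_of_ne h2, add_zero,
          Cell.pairing_zero]
      · simp
      · simp
    -- The continuity of `X` across the facet makes the two terms with X(r) r cancel, leaving only
    -- `a' - a`.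
    simp only [ofLp_sub_mulVec, smul_sub] at key ⊢
    rw [← sub_eq_zero, ← key]
    abel
  have hd1 : ((d : ℝ) + 1)⁻¹ ≠ 0 := by positivity
  have hedge : ∀ {E : M.Cell} {p r : Pt d}, p ∈ E.verts → r ∈ E.verts → p ∈ M.domain →
      X r = X p := by
    refine skew_eq_of_edge hd hXs fun E E' a a' ha ha' he hne r hr s hs => ?_
    have h1 := (hpair E E' a a' ha ha' he hne r hr).symm.trans (hpair E E' a a' ha ha' he hne s hs)
    rw [Matrix.sub_mulVec, sub_eq_zero]
    exact smul_right_injective _ hd1 h1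
  obtain ⟨C, hC, hpart⟩ := hM
  -- `c E` is an interior vertex of `E`; all other vertices of `E` are joined to it by an edge.
  choose c hc _ using hpart
  have hcell : ∀ E : M.Cell, ∀ r ∈ E.verts, X r = X (c E) := fun E r hr =>
    hedge (hc E).2 hr (hC _ (hc E).1).2
  have hconst := eq_of_facet_adjacent (M := M) (f := fun E => X (c E))
    fun E E' a a' ha ha' he hne => by
      obtain ⟨r, hr⟩ : (E.verts.erase a).Nonempty := by
        rw [← Finset.card_pos, Finset.card_erase_of_mem ha, E.card_verts]
        omega
      exact (hcell E r (Finset.mem_of_mem_erase hr)).symm.trans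
        (hcell E' r (Finset.mem_of_mem_erase (he ▸ hr)))
  obtain ⟨F, hF, hFc, hFb, hFN⟩ := M.exists_dirichlet
  obtain ⟨E₀, hFE⟩ := exists_cell_of_face hF
  obtain ⟨a, ha, haF⟩ : ∃ a ∈ E₀.verts, E₀.verts.erase a = F := by
    obtain ⟨a, ha, haF⟩ := Finset.exists_mem_notMem_of_card_lt_card
      (show F.card < E₀.verts.card by rw [hFc, E₀.card_verts]; omega)
    refine ⟨a, ha, (Finset.eq_of_subset_of_card_le (fun s hs => ?_) ?_).symm⟩
    · exact Finset.mem_erase.2 ⟨fun h => haF (h ▸ hs), hFE hs⟩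
    · rw [Finset.card_erase_of_mem ha, E₀.card_verts, hFc]; omega
  subst haF
  have hdir : ∀ r ∈ E₀.verts.erase a,
      v E₀ = ((d : ℝ) + 1)⁻¹ • (X (c E₀) *ᵥ (a - r).ofLp) := by
    intro r hr
    rw [← hcell E₀ r (Finset.mem_of_mem_erase hr), eq_comm, ← sub_eq_zero]
    refine dotProduct_eq_zero _ fun t => ?_
    have h1 := h _ (single_mem_stressSpace ha hr ⟨⟨⟨hF, hFc⟩, hFb⟩, hFN⟩ t)
    rw [divForm_add_rotationForm, Finset.sum_eq_single E₀] at h1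
    · rw [Pi.single_eq_same, E₀.pairing_piece ha hr,
        hXv E₀ r (Finset.mem_of_mem_erase hr)] at h1
      rw [dotProduct_comm, h1]
    · intro K _ hK
      rw [Pi.single_eq_of_ne hK, Cell.pairing_zero]
    · simp
  obtain ⟨r, hr⟩ : (E₀.verts.erase a).Nonempty := by
    rw [← Finset.card_pos, Finset.card_erase_of_mem ha, E₀.card_verts]
    omega
  -- The displacement on `E₀` is the same for all vertices `r` of the Dirichlet facet, so the matrix
  -- annihilates every edge of that facet.
  have hN : X (c E₀) = 0 := by
    refine E₀.skew_eq_zero (hXs _ (Cell.mem_vertices (hc E₀).2)) (a := a) (r := r)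
      fun s hs => ?_
    have h1 := smul_right_injective _ hd1 ((hdir r hr).symm.trans (hdir s hs))
    simp only [ofLp_sub_mulVec] at h1 ⊢
    rw [sub_right_inj] at h1
    rw [h1, sub_self]
  have hX0 : ∀ (E : M.Cell), ∀ r ∈ E.verts, X r = 0 := fun E r hr =>
    (hcell E r hr).trans ((hconst E E₀).trans hN)
  have hv := eq_of_facet_adjacent (M := M) (f := v) fun E E' a a' ha ha' he hne => by
    obtain ⟨r, hr⟩ : (E.verts.erase a).Nonempty := by
      rw [← Finset.card_pos, Finset.card_erase_of_mem ha, E.card_verts]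
      omega
    have h1 := hpair E E' a a' ha ha' he hne r hr
    rw [hX0 E r (Finset.mem_of_mem_erase hr), Matrix.zero_mulVec, smul_zero, sub_eq_zero] at h1
    exact h1.symm
  refine ⟨funext fun E => ?_, funext fun E => E.affineMap_ext fun r hr => ?_⟩
  · rw [hv E E₀, hdir r hr, hN, Matrix.zero_mulVec, smul_zero]; rfl
  · rw [hXv E r hr, hX0 E r hr]; rfl

end MSMFE.Mesh

namespace MSMFE

/-! ### Elimination in saddle point systems -/

section saddle

variable {m n k : Type*} [Fintype m] [Fintype n] [Fintype k] [DecidableEq n]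
  {A : Matrix n n ℝ} {P : Matrix m n ℝ} {G : Matrix k n ℝ}

/-- A congruence of A⁻¹ by `Gᵀ`, whose injectivity is the case `u = 0` of `hinj`. -/
lemma posDef_schur_lower (hA : A.PosDef)
    (hinj : ∀ (u : m → ℝ) (γ : k → ℝ), Pᵀ *ᵥ u + Gᵀ *ᵥ γ = 0 → u = 0 ∧ γ = 0) :
    (G * A⁻¹ * Gᵀ).PosDef := by
  have h := hA.inv.conjTranspose_mul_mul_same (B := Gᵀ) ?_
  · rwa [Matrix.conjTranspose_eq_transpose_of_trivial, Matrix.transpose_transpose] at h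
  · intro x y hxy
    have h0 := (hinj 0 (x - y) (by
      rw [Matrix.mulVec_zero, zero_add, Matrix.mulVec_sub, sub_eq_zero]; exact hxy)).2
    exact sub_eq_zero.1 h0

/-- The matrix equals Bᵀ A⁻¹ B, where B is `Pᵀ` minus its A⁻¹-orthogonal projection onto the range
of `Gᵀ`. If B u = 0, then Pᵀ u lies in the range of `Gᵀ`, so joint injectivity gives u = 0. -/
lemma posDef_schur_upper [DecidableEq k] (hA : A.PosDef)
    (hinj : ∀ (u : m → ℝ) (γ : k → ℝ), Pᵀ *ᵥ u + Gᵀ *ᵥ γ = 0 → u = 0 ∧ γ = 0) :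
    (P * A⁻¹ * Pᵀ - P * A⁻¹ * Gᵀ * (G * A⁻¹ * Gᵀ)⁻¹ * (G * A⁻¹ * Pᵀ)).PosDef := by
  have hC := posDef_schur_lower hA hinj
  have hCt : ((G * A⁻¹ * Gᵀ)⁻¹)ᵀ = (G * A⁻¹ * Gᵀ)⁻¹ := by
    have := hC.inv.1
    rwa [Matrix.IsHermitian, Matrix.conjTranspose_eq_transpose_of_trivial] at this
  have hAt : (A⁻¹)ᵀ = A⁻¹ := by
    have := hA.inv.1
    rwa [Matrix.IsHermitian, Matrix.conjTranspose_eq_transpose_of_trivial] at this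
  have hCC : (G * A⁻¹ * Gᵀ) * (G * A⁻¹ * Gᵀ)⁻¹ = 1 :=
    Matrix.mul_nonsing_inv _ ((Matrix.isUnit_iff_isUnit_det _).1 hC.isUnit)
  set H := A⁻¹ with hH
  set D := (G * H * Gᵀ)⁻¹ with hD
  have h := hA.inv.conjTranspose_mul_mul_same (B := Pᵀ - Gᵀ * (D * (G * H * Pᵀ))) ?_
  · convert! h using 1
    rw [Matrix.conjTranspose_eq_transpose_of_trivial, ← hH]
    simp only [Matrix.transpose_sub, Matrix.transpose_mul, Matrix.transpose_transpose, hAt, hCt]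
    have e1 : P * (H * Gᵀ) * D * G * H * (Gᵀ * (D * (G * H * Pᵀ))) =
        P * (H * Gᵀ) * D * (G * H * Pᵀ) := by
      calc _ = P * (H * Gᵀ) * D * ((G * H * Gᵀ) * D) * (G * H * Pᵀ) := by
            simp only [Matrix.mul_assoc]
        _ = _ := by rw [hCC, Matrix.mul_one]
    simp only [Matrix.sub_mul, Matrix.mul_sub]
    rw [e1]
    simp only [Matrix.mul_assoc]
    abel
  · intro x y hxy
    have h0 := (hinj (x - y) (-((D * (G * H * Pᵀ)) *ᵥ (x - y))) (by
      have : (Pᵀ - Gᵀ * (D * (G * H * Pᵀ))) *ᵥ (x - y) = 0 := by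
        rw [Matrix.mulVec_sub, sub_eq_zero]; exact hxy
      rw [Matrix.sub_mulVec, ← Matrix.mulVec_mulVec] at this
      rw [Matrix.mulVec_neg, ← sub_eq_add_neg]
      exact this)).1
    exact sub_eq_zero.1 h0

lemma saddle_elimination [DecidableEq k] (hA : IsUnit A) (hC : IsUnit (G * A⁻¹ * Gᵀ)) (g σ : n → ℝ) (f u : m → ℝ)
    (γ : k → ℝ) :
    (A.mulVec σ + Pᵀ.mulVec u + Gᵀ.mulVec γ = g ∧ -(P.mulVec σ) = -f ∧ -(G.mulVec σ) = 0) ↔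
      ((P * A⁻¹ * Pᵀ - P * A⁻¹ * Gᵀ * (G * A⁻¹ * Gᵀ)⁻¹ * (G * A⁻¹ * Pᵀ)).mulVec u =
          (P * A⁻¹).mulVec g - f - (P * A⁻¹ * Gᵀ * (G * A⁻¹ * Gᵀ)⁻¹ * G * A⁻¹).mulVec g ∧
        γ = (G * A⁻¹ * Gᵀ)⁻¹.mulVec ((G * A⁻¹).mulVec (g - Pᵀ.mulVec u)) ∧
        σ = A⁻¹.mulVec (g - Pᵀ.mulVec u - Gᵀ.mulVec γ)) := by
  have hAA : ∀ x, A *ᵥ (A⁻¹ *ᵥ x) = x := fun x => by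
    rw [Matrix.mulVec_mulVec, Matrix.mul_nonsing_inv _ ((Matrix.isUnit_iff_isUnit_det _).1 hA),
      Matrix.one_mulVec]
  have hAA' : ∀ x, A⁻¹ *ᵥ (A *ᵥ x) = x := fun x => by
    rw [Matrix.mulVec_mulVec, Matrix.nonsing_inv_mul _ ((Matrix.isUnit_iff_isUnit_det _).1 hA),
      Matrix.one_mulVec]
  have hCC : ∀ x, G *ᵥ (A⁻¹ *ᵥ (Gᵀ *ᵥ ((G * A⁻¹ * Gᵀ)⁻¹ *ᵥ x))) = x := fun x => by
    rw [Matrix.mulVec_mulVec, Matrix.mulVec_mulVec, Matrix.mulVec_mulVec,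
      Matrix.mul_nonsing_inv _ ((Matrix.isUnit_iff_isUnit_det _).1 hC),
      Matrix.one_mulVec]
  have hCC' : ∀ x, (G * A⁻¹ * Gᵀ)⁻¹ *ᵥ (G *ᵥ (A⁻¹ *ᵥ (Gᵀ *ᵥ x))) = x := fun x => by
    rw [Matrix.mulVec_mulVec _ A⁻¹, Matrix.mulVec_mulVec _ G, ← Matrix.mul_assoc,
      Matrix.mulVec_mulVec, Matrix.nonsing_inv_mul _ ((Matrix.isUnit_iff_isUnit_det _).1 hC),
      Matrix.one_mulVec]
  generalize hD : (G * A⁻¹ * Gᵀ)⁻¹ = D at *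
  simp only [Matrix.sub_mulVec, ← Matrix.mulVec_mulVec, neg_inj, neg_eq_zero, Matrix.mulVec_sub]
  constructor
  · rintro ⟨h1, h2, h3⟩
    have hσ : σ = A⁻¹ *ᵥ g - A⁻¹ *ᵥ (Pᵀ *ᵥ u) - A⁻¹ *ᵥ (Gᵀ *ᵥ γ) := by
      rw [← h1]
      simp only [Matrix.mulVec_add, hAA']
      abel
    -- Insert the stress into the third equation and apply the inverse of the rotation matrix.
    have hγ : γ = D *ᵥ (G *ᵥ (A⁻¹ *ᵥ g)) - D *ᵥ (G *ᵥ (A⁻¹ *ᵥ (Pᵀ *ᵥ u))) := by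
      rw [hσ] at h3
      simp only [Matrix.mulVec_sub] at h3
      rw [← hCC' γ, ← sub_eq_zero.1 h3, Matrix.mulVec_sub]
    refine ⟨?_, hγ, hσ⟩
    rw [hσ] at h2
    simp only [Matrix.mulVec_sub] at h2
    rw [hγ] at h2
    simp only [Matrix.mulVec_sub] at h2
    rw [← h2]
    abel
  · rintro ⟨h1, h2, h3⟩
    refine ⟨?_, ?_, ?_⟩
    · rw [h3]
      simp only [Matrix.mulVec_sub, hAA]
      abel
    · rw [h3]
      simp only [Matrix.mulVec_sub]
      rw [h2]
      simp only [Matrix.mulVec_sub]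
      rw [sub_eq_iff_eq_add] at h1
      rw [h1]
      abel
    · rw [h3]
      simp only [Matrix.mulVec_sub]
      rw [h2]
      simp only [Matrix.mulVec_sub, hCC]
      abel

end saddle

namespace Mesh

open scoped Classical

variable {d : ℕ} {M : Mesh d}

/-! ### The bilinear forms -/

lemma ddot_add_left (σ σ' τ : Tensor d) : ddot (σ + σ') τ = ddot σ τ + ddot σ' τ := by
  simp only [ddot, Matrix.add_apply, add_mul, Finset.sum_add_distrib]

lemma ddot_comm (σ τ : Tensor d) : ddot σ τ = ddot τ σ := by
  simp only [ddot, mul_comm]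

lemma ddot_add_right (σ τ τ' : Tensor d) : ddot σ (τ + τ') = ddot σ τ + ddot σ τ' := by
  rw [ddot_comm, ddot_add_left, ddot_comm τ, ddot_comm τ']

lemma ddot_smul_right (c : ℝ) (σ τ : Tensor d) : ddot σ (c • τ) = c * ddot σ τ := by
  rw [ddot_comm, ddot_smul_left, ddot_comm]

lemma ddot_self_nonneg (τ : Tensor d) : 0 ≤ ddot τ τ :=
  Finset.sum_nonneg fun _ _ => Finset.sum_nonneg fun _ _ => mul_self_nonneg _

lemma ddot_self_eq_zero {τ : Tensor d} (h : ddot τ τ = 0) : τ = 0 := by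
  ext i j
  have h1 := (Finset.sum_eq_zero_iff_of_nonneg fun i _ =>
    Finset.sum_nonneg fun j _ => mul_self_nonneg (τ i j)).1 h i (Finset.mem_univ i)
  have h2 := (Finset.sum_eq_zero_iff_of_nonneg fun j _ => mul_self_nonneg (τ i j)).1 h1 j
    (Finset.mem_univ j)
  exact mul_self_eq_zero.1 h2

/-- The form `(Aχ, τ)_Q` as a bilinear map. -/
noncomputable def stressBilin (A : M.Cell → Pt d → Tensor d →ₗ[ℝ] Tensor d) :
    M.BrokenP1 →ₗ[ℝ] M.BrokenP1 →ₗ[ℝ] ℝ :=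
  LinearMap.mk₂ ℝ (M.stressForm A)
    (fun χ χ' τ => by
      simp only [stressForm, Pi.add_apply, AffineMap.coe_add, map_add, ddot_add_left,
        Finset.sum_add_distrib, mul_add])
    (fun c χ τ => by
      simp only [stressForm, Pi.smul_apply, AffineMap.coe_smul, map_smul, ddot_smul_left,
        ← Finset.mul_sum, smul_eq_mul]
      rw [Finset.mul_sum]
      exact Finset.sum_congr rfl fun E _ => by ring)
    (fun χ τ τ' => by
      simp only [stressForm, Pi.add_apply, AffineMap.coe_add, ddot_add_right,
        Finset.sum_add_distrib, mul_add])
    (fun c χ τ => by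
      simp only [stressForm, Pi.smul_apply, AffineMap.coe_smul, ddot_smul_right,
        ← Finset.mul_sum, smul_eq_mul]
      rw [Finset.mul_sum]
      exact Finset.sum_congr rfl fun E _ => by ring)

/-- The form `(τ, ξ)_Q` as a bilinear map. -/
noncomputable def rotationBilin : M.BrokenP1 →ₗ[ℝ] M.BrokenP1 →ₗ[ℝ] ℝ :=
  stressBilin fun _ _ => LinearMap.id

lemma rotationBilin_apply (τ ξ : M.BrokenP1) : rotationBilin τ ξ = M.rotationForm τ ξ := rfl

lemma affineDiv_add (f g : Pt d →ᵃ[ℝ] Tensor d) (i : Fin d) :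
    affineDiv (f + g) i = affineDiv f i + affineDiv g i := by
  simp [affineDiv, Finset.sum_add_distrib]

lemma affineDiv_smul (c : ℝ) (f : Pt d →ᵃ[ℝ] Tensor d) (i : Fin d) :
    affineDiv (c • f) i = c * affineDiv f i := by
  simp [affineDiv, Finset.mul_sum]

/-- The form `(div τ, v)` as a bilinear map. -/
noncomputable def divBilin : M.BrokenP1 →ₗ[ℝ] M.DisplacementSpace →ₗ[ℝ] ℝ :=
  LinearMap.mk₂ ℝ M.divForm
    (fun τ τ' v => by
      simp only [divForm_eq, Pi.add_apply, affineDiv_add, add_mul, Finset.sum_add_distrib, mul_add])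
    (fun c τ v => by
      simp only [divForm_eq, Pi.smul_apply, affineDiv_smul, mul_assoc, ← Finset.mul_sum,
        smul_eq_mul]
      rw [Finset.mul_sum]
      exact Finset.sum_congr rfl fun E _ => by ring)
    (fun τ v v' => by
      simp only [divForm_eq, Pi.add_apply, Finset.sum_add_distrib, mul_add])
    (fun c τ v => by
      simp only [divForm_eq, Pi.smul_apply, smul_eq_mul, mul_left_comm _ c, ← Finset.mul_sum])

lemma stressForm_comm {A : M.Cell → Pt d → Tensor d →ₗ[ℝ] Tensor d} (hA : M.IsCompliance A)
    (χ τ : M.BrokenP1) : M.stressForm A χ τ = M.stressForm A τ χ := by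
  refine Finset.sum_congr rfl fun E _ => congrArg _ (Finset.sum_congr rfl fun r hr => ?_)
  rw [hA.symm E r (E.verts_subset_carrier hr), ddot_comm]

/-- All vertex terms are nonnegative with positive weights. If they all vanish, coercivity makes the
field zero at every vertex of every element, and affine fields are determined there. -/
lemma stressForm_self_pos {A : M.Cell → Pt d → Tensor d →ₗ[ℝ] Tensor d} (hA : M.IsCompliance A)
    {τ : M.BrokenP1} (hτ : τ ≠ 0) : 0 < M.stressForm A τ τ := by
  obtain ⟨a₀, a₁, ha₀, hb⟩ := hA.bounds
  have hterm : ∀ E : M.Cell, ∀ r ∈ E.verts, 0 ≤ ddot (A E r (τ E r)) (τ E r) := fun E r hr =>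
    (mul_nonneg ha₀.le (ddot_self_nonneg _)).trans (hb E r (E.verts_subset_carrier hr) _).1
  have hcoef : ∀ E : M.Cell, 0 < E.vol / ((d : ℝ) + 1) := fun E =>
    div_pos E.vol_pos (by positivity)
  have hnn : ∀ E ∈ (Finset.univ : Finset M.Cell),
      0 ≤ E.vol / ((d : ℝ) + 1) * ∑ r ∈ E.verts, ddot (A E r (τ E r)) (τ E r) := fun E _ =>
    mul_nonneg (hcoef E).le (Finset.sum_nonneg (hterm E))
  refine (Finset.sum_nonneg hnn).lt_of_ne fun h0 => hτ ?_
  funext E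
  refine E.affineMap_ext fun r hr => ?_
  have h1 := (Finset.sum_eq_zero_iff_of_nonneg hnn).1 h0.symm E (Finset.mem_univ E)
  have h2 := (Finset.sum_eq_zero_iff_of_nonneg (hterm E)).1
    ((mul_eq_zero.1 h1).resolve_left (hcoef E).ne') r hr
  have h3 := (hb E r (E.verts_subset_carrier hr) (τ E r)).1
  rw [h2] at h3
  exact ddot_self_eq_zero (le_antisymm (nonpos_of_mul_nonpos_right h3 ha₀) (ddot_self_nonneg _))

/-! ### The matrices in arbitrary bases -/

section matrices

variable {ισ ιu ιγ : Type*} [Fintype ιu] [Fintype ιγ]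

lemma matSS_posDef [Fintype ισ] {A : M.Cell → Pt d → Tensor d →ₗ[ℝ] Tensor d} (hA : M.IsCompliance A)
    (τ : Module.Basis ισ ℝ M.stressSpace) : (M.matSS A τ).PosDef := by
  refine Matrix.PosDef.of_dotProduct_mulVec_pos ?_ fun x hx => ?_
  · ext i j
    simp only [Matrix.conjTranspose_apply, star_trivial, matSS, Matrix.of_apply]
    exact stressForm_comm hA _ _
  · set χ : M.stressSpace := τ.equivFun.symm x with hχ
    have hχ0 : (χ : M.BrokenP1) ≠ 0 := fun h => hx (by
      have : χ = 0 := Subtype.ext h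
      exact τ.equivFun.symm.map_eq_zero_iff.1 this)
    have hsum : (χ : M.BrokenP1) = ∑ j, x j • (τ j : M.BrokenP1) := by
      rw [hχ, Module.Basis.equivFun_symm_apply]
      simp
    have h1 : star x ⬝ᵥ (M.matSS A τ *ᵥ x) = stressBilin A χ χ := by
      rw [hsum, map_sum (stressBilin A (∑ j, x j • (τ j : M.BrokenP1)))]
      refine Finset.sum_congr rfl fun i _ => ?_
      rw [map_smul, map_sum, LinearMap.sum_apply, smul_eq_mul, star_trivial]
      refine congrArg _ (Finset.sum_congr rfl fun j _ => ?_)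
      rw [map_smul, LinearMap.smul_apply, smul_eq_mul, mul_comm]
      rfl
    rw [h1]
    exact stressForm_self_pos hA hχ0

/-- The transposes of the divergence and rotation matrices are jointly injective. -/
lemma matSU_matSG_injective (hd : d = 2 ∨ d = 3) (hM : M.HasMacroelementPartition)
    (τ : Module.Basis ισ ℝ M.stressSpace) (v : Module.Basis ιu ℝ M.DisplacementSpace)
    (ξ : Module.Basis ιγ ℝ M.rotationSpace) (u : ιu → ℝ) (γ : ιγ → ℝ)
    (h : (M.matSU τ v)ᵀ *ᵥ u + (M.matSG τ ξ)ᵀ *ᵥ γ = 0) : u = 0 ∧ γ = 0 := by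
  set w : M.DisplacementSpace := v.equivFun.symm u with hw
  set η : M.rotationSpace := ξ.equivFun.symm γ with hη
  have hws : w = ∑ i, u i • v i := by rw [hw, Module.Basis.equivFun_symm_apply]
  have hηs : (η : M.BrokenP1) = ∑ i, γ i • (ξ i : M.BrokenP1) := by
    rw [hη, Module.Basis.equivFun_symm_apply]
    simp
  have hbasis : ∀ j, M.divForm (τ j) w + M.rotationForm (τ j) η = 0 := by
    intro j
    have hj := congrFun h j
    have e1 : M.divForm (τ j) w = ((M.matSU τ v)ᵀ *ᵥ u) j := by
      change divBilin (τ j : M.BrokenP1) w = _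
      rw [hws]
      simp only [map_sum, map_smul, smul_eq_mul, Matrix.mulVec, dotProduct, Matrix.transpose_apply,
        matSU, Matrix.of_apply, mul_comm]
      rfl
    have e2 : M.rotationForm (τ j) η = ((M.matSG τ ξ)ᵀ *ᵥ γ) j := by
      rw [← rotationBilin_apply, hηs]
      simp only [map_sum, map_smul, smul_eq_mul, Matrix.mulVec, dotProduct, Matrix.transpose_apply,
        matSG, Matrix.of_apply, mul_comm]
      rfl
    rw [e1, e2]
    exact hj
  -- Both forms are linear in the stress, so testing with a basis is enough.
  have hall : ∀ χ ∈ M.stressSpace, M.divForm χ w + M.rotationForm χ η = 0 := by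
    have hlin : ((divBilin.flip w + rotationBilin.flip (η : M.BrokenP1)).comp
        M.stressSpace.subtype) = 0 := τ.ext fun j => hbasis j
    intro χ hχ
    exact LinearMap.congr_fun hlin ⟨χ, hχ⟩
  obtain ⟨h1, h2⟩ := eq_zero_of_divForm_add_rotationForm hd hM η.2 hall
  refine ⟨?_, ?_⟩
  · exact v.equivFun.symm.map_eq_zero_iff.1 h1
  · have : η = 0 := Subtype.ext h2
    exact ξ.equivFun.symm.map_eq_zero_iff.1 this

end matrices

end Mesh

/-! ### Block-diagonal matrices -/

/-- The inverse of a block-diagonal matrix is block-diagonal. -/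
lemma inv_apply_eq_zero_of_block {n α : Type*} [Fintype n] [DecidableEq n] {A : Matrix n n ℝ}
    (hA : IsUnit A) {p : n → α} (h : ∀ i j, p i ≠ p j → A i j = 0) {i j : n} (hij : p i ≠ p j) :
    A⁻¹ i j = 0 := by
  classical
  have hdet := (Matrix.isUnit_iff_isUnit_det _).1 hA
  -- The coordinate projector onto the block of `i` commutes with `A`, hence with its inverse; the
  -- entry (i, j) of that identity is the claim.
  set D : Matrix n n ℝ := Matrix.diagonal fun k => if p k = p i then 1 else 0 with hD
  have hcomm : D * A = A * D := by
    ext k l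
    rw [hD, Matrix.diagonal_mul, Matrix.mul_diagonal]
    by_cases hkl : p k = p l
    · rw [hkl, mul_comm]
    · rw [h k l hkl, mul_zero, zero_mul]
  have hinv : D * A⁻¹ = A⁻¹ * D := by
    calc D * A⁻¹ = A⁻¹ * (A * D) * A⁻¹ := by
          rw [Matrix.nonsing_inv_mul_cancel_left _ _ hdet]
      _ = A⁻¹ * D := by
          rw [← hcomm, Matrix.mul_assoc, Matrix.mul_assoc, Matrix.mul_nonsing_inv _ hdet,
            Matrix.mul_one]
  have hentry := congrFun (congrFun hinv i) j
  rw [hD, Matrix.diagonal_mul, Matrix.mul_diagonal, if_pos rfl, if_neg (Ne.symm hij), one_mul,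
    mul_zero] at hentry
  exact hentry

lemma blockDiagonal_isUnit {m o : Type*} [Fintype m] [DecidableEq m] [Fintype o] [DecidableEq o]
    {B : o → Matrix m m ℝ} (h : IsUnit (Matrix.blockDiagonal B)) (r : o) : IsUnit (B r) := by
  rw [Matrix.isUnit_iff_isUnit_det, Matrix.det_blockDiagonal] at h
  rw [Matrix.isUnit_iff_isUnit_det]
  exact isUnit_of_dvd_unit
    (Finset.dvd_prod_of_mem (fun k => (B k).det) (Finset.mem_univ r)) h

namespace Mesh

open scoped Classical

variable {d : ℕ} {M : Mesh d}

/-! ### The nodal bases -/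

lemma Cell.sum_bary_linear_smul (E : M.Cell) (r w : Pt d) :
    ∑ s ∈ E.verts, (E.bary s).linear w • (s - r) = w := by
  have h : ∀ s, (E.bary s).linear w = E.bary s (r + w) - E.bary s r := fun s => by
    rw [Cell.bary_add]; ring
  simp only [h, sub_smul, smul_sub, Finset.sum_sub_distrib, ← Finset.sum_smul]
  rw [E.sum_bary_smul, E.sum_bary_smul, E.sum_bary, E.sum_bary]
  abel

lemma Cell.erase_mem_facets {E : M.Cell} {a r : Pt d} (ha : a ∈ E.verts)
    (hr : r ∈ E.verts.erase a) : E.verts.erase a ∈ M.facets := by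
  refine ⟨M.complex.down_closed E.2.1 (Finset.erase_subset _ _) ⟨r, hr⟩, ?_⟩
  rw [Finset.card_erase_of_mem ha, E.card_verts]; rfl

/-- A vector that is orthogonal to the normals of all facets of `E` through a vertex vanishes. -/
lemma Cell.eq_zero_of_inner_normal {n : Finset (Pt d) → Pt d} (hn : M.IsUnitNormal n) {E : M.Cell}
    {r : Pt d} (hr : r ∈ E.verts) {w : Pt d}
    (h : ∀ a ∈ E.verts, a ≠ r → inner ℝ (n (E.verts.erase a)) w = 0) : w = 0 := by
  rw [← E.sum_bary_linear_smul r w]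
  refine Finset.sum_eq_zero fun a ha => ?_
  by_cases har : a = r
  · rw [har, sub_self, smul_zero]
  have hrF : r ∈ E.verts.erase a := Finset.mem_erase.2 ⟨Ne.symm har, hr⟩
  obtain ⟨hn1, hn2⟩ := hn _ (Cell.erase_mem_facets ha hrF)
  -- The normal annihilates the edges within its facet, so it is proportional to the derivative of
  -- λ_a. The factor is nonzero because the normal is, so the coefficient of `a - r` in `w` is zero.
  have hinner : ∀ y : Pt d, inner ℝ (n (E.verts.erase a)) y =
      (E.bary a).linear y * inner ℝ (n (E.verts.erase a)) (a - r) := by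
    intro y
    conv_lhs => rw [← E.sum_bary_linear_smul r y]
    rw [inner_sum, Finset.sum_eq_single a]
    · rw [inner_smul_right]
    · intro s hs hsa
      rw [inner_smul_right, hn2 s (Finset.mem_erase.2 ⟨hsa, hs⟩) r hrF, mul_zero]
    · exact fun h => absurd ha h
  have hne : inner ℝ (n (E.verts.erase a)) (a - r) ≠ 0 := by
    intro h0
    have h1 := hinner (n (E.verts.erase a))
    rw [h0, mul_zero, inner_self_eq_zero] at h1
    rw [h1, norm_zero] at hn1
    exact zero_ne_one hn1
  have h2 := (hinner w).symm.trans (h a ha har)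
  rw [(mul_eq_zero.1 h2).resolve_right hne, zero_smul]

/-- The vertex of a stress degree of freedom. -/
def StressDof.vertex (q : M.StressDof) : M.Vertex :=
  ⟨q.1.2.1, M.complex.down_closed q.2.1.1 (Finset.singleton_subset_iff.2 q.2.2.2)
    (Finset.singleton_nonempty _)⟩

/-- At a foreign vertex the normal components on all facets of `E` through it vanish, including
those on Neumann facets. Each row is thus orthogonal to all these normals, which span the space. -/
lemma nodalStress_eq_zero {n : Finset (Pt d) → Pt d} (hn : M.IsUnitNormal n)
    {τ : Module.Basis M.StressDof ℝ M.stressSpace} (hτ : M.IsNodalStressBasis n τ)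
    (q : M.StressDof) (E : M.Cell) {r : Pt d} (hr : r ∈ E.verts) (hq : q.vertex.1 ≠ r) :
    (τ q : M.BrokenP1) E r = 0 := by
  have hrow : ∀ i, WithLp.toLp 2 ((τ q : M.BrokenP1) E r i) = (0 : Pt d) := by
    intro i
    refine Cell.eq_zero_of_inner_normal hn hr fun a ha har => ?_
    have hrF : r ∈ E.verts.erase a := Finset.mem_erase.2 ⟨Ne.symm har, hr⟩
    have h := hτ q E _ (Cell.erase_mem_facets ha hrF) (Finset.erase_subset _ _) r hrF
    rw [if_neg fun h => hq h.2] at h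
    have hi := congrFun h i
    rw [EuclideanSpace.inner_eq_star_dotProduct]
    simpa [Matrix.mulVec] using hi
  ext i j
  have := congrArg (fun w : Pt d => w j) (hrow i)
  simpa using this

/-- At every quadrature node at least one of the two fields vanishes. -/
lemma matSS_nodal_eq_zero {n : Finset (Pt d) → Pt d} (hn : M.IsUnitNormal n)
    {τ : Module.Basis M.StressDof ℝ M.stressSpace} (hτ : M.IsNodalStressBasis n τ)
    (A : M.Cell → Pt d → Tensor d →ₗ[ℝ] Tensor d) (q q' : M.StressDof)
    (h : q.vertex ≠ q'.vertex) : M.matSS A τ q q' = 0 := by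
  refine Finset.sum_eq_zero fun E _ => ?_
  rw [Finset.sum_eq_zero, mul_zero]
  intro r hr
  by_cases hq : q.vertex.1 = r
  · rw [nodalStress_eq_zero hn hτ q' E hr fun h' => h (Subtype.ext (hq.trans h'.symm))]
    simp [ddot]
  · rw [nodalStress_eq_zero hn hτ q E hr hq]
    simp [ddot]

lemma matSG_nodal_eq_zero {n : Finset (Pt d) → Pt d} (hn : M.IsUnitNormal n)
    {τ : Module.Basis M.StressDof ℝ M.stressSpace} (hτ : M.IsNodalStressBasis n τ)
    {ξ : Module.Basis (Fin (d * (d - 1) / 2) × M.Vertex) ℝ M.rotationSpace}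
    (hξ : M.IsNodalRotationBasis ξ) (k : Fin (d * (d - 1) / 2)) (r : M.Vertex) (q : M.StressDof)
    (h : r ≠ q.vertex) : M.matSG τ ξ (k, r) q = 0 := by
  refine Finset.sum_eq_zero fun E _ => ?_
  rw [Finset.sum_eq_zero, mul_zero]
  intro s hs
  by_cases hq : q.vertex.1 = s
  · rw [hξ k r E s hs, if_neg fun h' => h (Subtype.ext (h'.symm.trans hq.symm))]
    simp [ddot]
  · rw [nodalStress_eq_zero hn hτ q E hs hq]
    simp [ddot]

/-- With respect to nodal bases, the rotation matrix is block-diagonal. -/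
lemma rotationMatrix_nodal {n : Finset (Pt d) → Pt d} (hn : M.IsUnitNormal n)
    {τ : Module.Basis M.StressDof ℝ M.stressSpace} (hτ : M.IsNodalStressBasis n τ)
    {ξ : Module.Basis (Fin (d * (d - 1) / 2) × M.Vertex) ℝ M.rotationSpace}
    (hξ : M.IsNodalRotationBasis ξ) {A : M.Cell → Pt d → Tensor d →ₗ[ℝ] Tensor d}
    (hA : M.IsCompliance A) :
    M.rotationMatrix A τ ξ =
      Matrix.blockDiagonal fun r => Matrix.of fun k l =>
        M.rotationMatrix A τ ξ (k, r) (l, r) := by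
  ext ⟨k, r⟩ ⟨l, s⟩
  rw [Matrix.blockDiagonal_apply]
  by_cases hrs : r = s
  · subst hrs
    rw [if_pos rfl, Matrix.of_apply]
  rw [if_neg hrs, rotationMatrix, Matrix.mul_apply]
  refine Finset.sum_eq_zero fun q' _ => ?_
  rw [Matrix.transpose_apply]
  -- A nonzero product would need a chain from `r` to `s` through two stress degrees of freedom,
  -- every link of which stays at the same vertex.
  by_cases hs : s = q'.vertex
  · rw [Matrix.mul_apply, Finset.sum_eq_zero, zero_mul]
    intro q _
    by_cases hr : r = q.vertex
    · rw [inv_apply_eq_zero_of_block (matSS_posDef hA τ).isUnit (p := StressDof.vertex)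
        (matSS_nodal_eq_zero hn hτ A), mul_zero]
      rw [← hr, ← hs]; exact hrs
    · rw [matSG_nodal_eq_zero hn hτ hξ k r q hr, zero_mul]
  · rw [matSG_nodal_eq_zero hn hτ hξ l s q' hs, mul_zero]

end Mesh

end MSMFE

/-! ### The main theorem -/

theorem mainTheorem9 (d : ℕ) (hd : d = 2 ∨ d = 3) (M : MSMFE.Mesh d)
    (hM : M.HasMacroelementPartition)
    (A : M.Cell → MSMFE.Pt d → MSMFE.Tensor d →ₗ[ℝ] MSMFE.Tensor d) (hA : M.IsCompliance A) :
    -- with respect to arbitrary bases of the three finite element spaces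
    (∀ (ισ ιu ιγ : Type) [Fintype ισ] [DecidableEq ισ] [Fintype ιu] [Fintype ιγ] [DecidableEq ιγ]
        (τ : Module.Basis ισ ℝ M.stressSpace) (v : Module.Basis ιu ℝ M.DisplacementSpace)
        (ξ : Module.Basis ιγ ℝ M.rotationSpace),
      let Ass := M.matSS A τ
      let Asu := M.matSU τ v
      let Asg := M.matSG τ ξ
      let C := M.rotationMatrix A τ ξ
      let S := M.displacementMatrix A τ v ξ
      -- the inverses below are true inverses
      Ass.PosDef ∧ IsUnit C ∧
      -- elimination of the stress and the rotation from the algebraic system of the method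
      (∀ (g σ : ισ → ℝ) (f u : ιu → ℝ) (γ : ιγ → ℝ),
        (Ass.mulVec σ + Asuᵀ.mulVec u + Asgᵀ.mulVec γ = g ∧
          -(Asu.mulVec σ) = -f ∧ -(Asg.mulVec σ) = 0) ↔
        (S.mulVec u = (Asu * Ass⁻¹).mulVec g - f
            - (Asu * Ass⁻¹ * Asgᵀ * C⁻¹ * Asg * Ass⁻¹).mulVec g ∧
          γ = C⁻¹.mulVec ((Asg * Ass⁻¹).mulVec (g - Asuᵀ.mulVec u)) ∧
          σ = Ass⁻¹.mulVec (g - Asuᵀ.mulVec u - Asgᵀ.mulVec γ))) ∧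
      -- the resulting displacement system
      S.IsSymm ∧ S.PosDef) ∧
    -- with respect to the nodal bases, the rotation matrix consists of one invertible
    -- `d(d-1)/2 × d(d-1)/2` diagonal block for each vertex of the mesh
    (∀ (n : Finset (MSMFE.Pt d) → MSMFE.Pt d) (_ : M.IsUnitNormal n)
        (τ : Module.Basis M.StressDof ℝ M.stressSpace) (_ : M.IsNodalStressBasis n τ)
        (ξ : Module.Basis (Fin (d * (d - 1) / 2) × M.Vertex) ℝ M.rotationSpace)
        (_ : M.IsNodalRotationBasis ξ),
      ∃ B : M.Vertex → Matrix (Fin (d * (d - 1) / 2)) (Fin (d * (d - 1) / 2)) ℝ,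
        M.rotationMatrix A τ ξ = Matrix.blockDiagonal B ∧ ∀ r, IsUnit (B r)) := by
  have hpart : ∀ (ισ ιu ιγ : Type) [Fintype ισ] [DecidableEq ισ] [Fintype ιu] [Fintype ιγ]
      [DecidableEq ιγ] (τ : Module.Basis ισ ℝ M.stressSpace)
      (v : Module.Basis ιu ℝ M.DisplacementSpace) (ξ : Module.Basis ιγ ℝ M.rotationSpace),
      (M.matSS A τ).PosDef ∧ (M.rotationMatrix A τ ξ).PosDef ∧
        (M.displacementMatrix A τ v ξ).PosDef := by
    intro ισ ιu ιγ _ _ _ _ _ τ v ξ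
    have h1 := MSMFE.Mesh.matSS_posDef hA τ
    have hinj := MSMFE.Mesh.matSU_matSG_injective hd hM τ v ξ
    exact ⟨h1, MSMFE.posDef_schur_lower h1 hinj, MSMFE.posDef_schur_upper h1 hinj⟩
  refine ⟨?_, ?_⟩
  · intro ισ ιu ιγ _ _ _ _ _ τ v ξ Ass Asu Asg C S
    obtain ⟨h1, h2, h3⟩ := hpart ισ ιu ιγ τ v ξ
    refine ⟨h1, h2.isUnit, fun g σ f u γ => ?_, ?_, h3⟩
    · exact MSMFE.saddle_elimination h1.isUnit h2.isUnit g σ f u γ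
    · have := h3.1
      rwa [Matrix.IsHermitian, Matrix.conjTranspose_eq_transpose_of_trivial] at this
  · intro n hn τ hτ ξ hξ
    -- The rotation matrix does not involve the displacement; some basis of that space is supplied
    -- only to apply joint injectivity.
    have hC := (hpart _ _ _ τ (Module.finBasis ℝ M.DisplacementSpace) ξ).2.1.isUnit
    have hB := MSMFE.Mesh.rotationMatrix_nodal hn hτ hξ hA
    rw [hB] at hC
    exact ⟨_, hB, MSMFE.blockDiagonal_isUnit hC⟩
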